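/- Let $N$ be a natural number and $R>0$. Consider the $2(2N+1)$-dimensional real vector space of maps $f=(x,y):S^1\to\mathbb R^2$ of the form $$x(\varphi)=a_0+\sum_{j=1}^N\left(a_j\cos j\varphi+b_j\sin j\varphi\right),\qquad y(\varphi)=\tilde a_0+\sum_{j=1}^N\left(\tilde a_j\cos j\varphi+\tilde b_j\sin j\varphi\right),$$ with the $L_2$ Euclidean structure $\langle (x_1,y_1),(x_2,y_2)\rangle=\frac1\pi\int_0^{2\pi}\left(x_1x_2+y_1y_2\right)d\varphi$. Let $B(N,R)$ be the ball of radius $R$ centred at the origin of this space, and let $B^2(N,R)=B(N,R)\times B(N,R)$, the set of pairs of curves both lying in $B(N,R)$, with its Euclidean volume (the product volume, in dimension $4(2N+1)$). For almost all pairs $(f,g)\in B^2(N,R)$ the number of intersection points of the two curves is finite and unambiguous: the number of points of $f(S^1)\cap g(S^1)$ equals the number of $(\varphi,\psi)\in S^1\times S^1$ with $f(\varphi)=g(\psi)$. For $i\ge 0$, the set of pairs in $B^2(N,R)$ with exactly $i$ intersection points is measurable (up to a null set); let $A_i(N)$ be its volume divided by the volume of $B^2(N,R)$. Then the average number of intersection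 points is $$\sum_{i=0}^\infty i\cdot A_i(N)=\frac{2^{8N+3}\,((2N)!)^4}{((4N+1)!)^2}\left(1+4+\cdots+N^2\right),$$ for every radius $R>0$. -/

import Mathlib

open MeasureTheory Set
open scoped Nat

noncomputable section

/-- Coefficients `(a₀, (a₁, …, a_N), (b₁, …, b_N))` of a real trigonometric polynomial of
degree at most `N`; the entry with index `j : Fin N` belongs to the frequency `j + 1`. -/
abbrev TrigPoly (N : ℕ) : Type := ℝ × (Fin N → ℝ) × (Fin N → ℝ)

/-- `a₀ + a₁ cos t + ⋯ + a_N cos Nt + b₁ sin t + ⋯ + b_N sin Nt`. -/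
def TrigPoly.eval {N : ℕ} (p : TrigPoly N) (t : ℝ) : ℝ :=
  p.1 + ∑ j : Fin N, p.2.1 j * Real.cos (((j : ℕ) + 1 : ℕ) * t)
    + ∑ j : Fin N, p.2.2 j * Real.sin (((j : ℕ) + 1 : ℕ) * t)

/-- The space of maps from the circle to the plane both of whose coordinates are trigonometric
polynomials of degree at most `N`: a real vector space of dimension `2 * (2 * N + 1)`. -/
@[ext]
structure TrigCurve (N : ℕ) : Type where
  /-- The first coordinate of the curve. -/
  xPoly : TrigPoly N
  /-- The second coordinate of the curve. -/
  yPoly : TrigPoly N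

namespace TrigCurve

variable {N : ℕ}

/-- A curve is a pair of trigonometric polynomials. -/
def equivProd (N : ℕ) : TrigCurve N ≃ TrigPoly N × TrigPoly N where
  toFun f := (f.xPoly, f.yPoly)
  invFun p := ⟨p.1, p.2⟩

instance : AddCommGroup (TrigCurve N) := (equivProd N).addCommGroup

instance : Module ℝ (TrigCurve N) := (equivProd N).module ℝ

instance : FiniteDimensional ℝ (TrigCurve N) :=
  Module.Finite.equiv ((equivProd N).linearEquiv ℝ).symm

@[simp] theorem xPoly_zero : (0 : TrigCurve N).xPoly = 0 := rfl

@[simp] theorem yPoly_zero : (0 : TrigCurve N).yPoly = 0 := rfl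

@[simp] theorem xPoly_add (f g : TrigCurve N) : (f + g).xPoly = f.xPoly + g.xPoly := rfl

@[simp] theorem yPoly_add (f g : TrigCurve N) : (f + g).yPoly = f.yPoly + g.yPoly := rfl

@[simp] theorem xPoly_smul (r : ℝ) (f : TrigCurve N) : (r • f).xPoly = r • f.xPoly := rfl

@[simp] theorem yPoly_smul (r : ℝ) (f : TrigCurve N) : (r • f).yPoly = r • f.yPoly := rfl

/-- The coordinate `x(t)` of the curve. -/
def x (f : TrigCurve N) (t : ℝ) : ℝ := f.xPoly.eval t

/-- The coordinate `y(t)` of the curve. -/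
def y (f : TrigCurve N) (t : ℝ) : ℝ := f.yPoly.eval t

/-- The point `(x(t), y(t))` of the plane; it is `2π`-periodic in `t`. -/
def point (f : TrigCurve N) (t : ℝ) : ℝ × ℝ := (f.x t, f.y t)

/-- The `L₂` dot product `(1/π) ∫₀^{2π} (x₁ x₂ + y₁ y₂) dt`. -/
def dot (f g : TrigCurve N) : ℝ :=
  (1 / Real.pi) * ∫ t in (0 : ℝ)..(2 * Real.pi), (f.x t * g.x t + f.y t * g.y t)

end TrigCurve

theorem TrigPoly.continuous_eval {N : ℕ} (p : TrigPoly N) : Continuous (TrigPoly.eval p) := by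
  unfold TrigPoly.eval
  fun_prop

theorem integral_cos_int_mul (k : ℤ) :
    ∫ t in (0 : ℝ)..(2 * Real.pi), Real.cos (k * t) = if k = 0 then 2 * Real.pi else 0 := by
  split_ifs with h
  · simp [h]
  · have hk : (k : ℝ) ≠ 0 := by exact_mod_cast h
    rw [intervalIntegral.integral_comp_mul_left (fun t => Real.cos t) hk]
    have : Real.sin ((k : ℝ) * (2 * Real.pi)) = 0 := by
      have := Real.sin_int_mul_pi (2 * k)
      push_cast at this
      rw [← this]; ring_nf
    simp [this]

theorem integral_sin_int_mul (k : ℤ) :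
    ∫ t in (0 : ℝ)..(2 * Real.pi), Real.sin (k * t) = 0 := by
  by_cases h : k = 0
  · simp [h]
  · have hk : (k : ℝ) ≠ 0 := by exact_mod_cast h
    rw [intervalIntegral.integral_comp_mul_left (fun t => Real.sin t) hk]
    have : Real.cos ((k : ℝ) * (2 * Real.pi)) = 1 := Real.cos_int_mul_two_pi k
    simp [this]

theorem integral_cos_mul_cos (m n : ℕ) :
    ∫ t in (0 : ℝ)..(2 * Real.pi), Real.cos ((m + 1 : ℕ) * t) * Real.cos ((n + 1 : ℕ) * t)
      = if m = n then Real.pi else 0 := by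
  have h : ∀ t : ℝ, Real.cos ((m + 1 : ℕ) * t) * Real.cos ((n + 1 : ℕ) * t)
      = (1 / 2) * (Real.cos (((m : ℤ) - n : ℤ) * t) + Real.cos (((m : ℤ) + n + 2 : ℤ) * t)) := by
    intro t
    have h1 : (((m : ℤ) - n : ℤ) : ℝ) * t = (m + 1 : ℕ) * t - (n + 1 : ℕ) * t := by
      push_cast; ring
    have h2 : (((m : ℤ) + n + 2 : ℤ) : ℝ) * t = (m + 1 : ℕ) * t + (n + 1 : ℕ) * t := by
      push_cast; ring
    rw [h1, h2, Real.cos_sub, Real.cos_add]; ring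
  simp_rw [h]
  rw [intervalIntegral.integral_const_mul, intervalIntegral.integral_add
    (Continuous.intervalIntegrable (by fun_prop) _ _)
    (Continuous.intervalIntegrable (by fun_prop) _ _), integral_cos_int_mul, integral_cos_int_mul]
  rw [if_neg (show ¬ ((m : ℤ) + n + 2 = 0) by omega)]
  by_cases hmn : m = n
  · simp [hmn]
  · rw [if_neg hmn, if_neg (by omega)]; simp

theorem integral_sin_mul_sin (m n : ℕ) :
    ∫ t in (0 : ℝ)..(2 * Real.pi), Real.sin ((m + 1 : ℕ) * t) * Real.sin ((n + 1 : ℕ) * t)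
      = if m = n then Real.pi else 0 := by
  have h : ∀ t : ℝ, Real.sin ((m + 1 : ℕ) * t) * Real.sin ((n + 1 : ℕ) * t)
      = (1 / 2) * (Real.cos (((m : ℤ) - n : ℤ) * t) - Real.cos (((m : ℤ) + n + 2 : ℤ) * t)) := by
    intro t
    have h1 : (((m : ℤ) - n : ℤ) : ℝ) * t = (m + 1 : ℕ) * t - (n + 1 : ℕ) * t := by
      push_cast; ring
    have h2 : (((m : ℤ) + n + 2 : ℤ) : ℝ) * t = (m + 1 : ℕ) * t + (n + 1 : ℕ) * t := by
      push_cast; ring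
    rw [h1, h2, Real.cos_sub, Real.cos_add]; ring
  simp_rw [h]
  rw [intervalIntegral.integral_const_mul, intervalIntegral.integral_sub
    (Continuous.intervalIntegrable (by fun_prop) _ _)
    (Continuous.intervalIntegrable (by fun_prop) _ _), integral_cos_int_mul, integral_cos_int_mul]
  rw [if_neg (show ¬ ((m : ℤ) + n + 2 = 0) by omega)]
  by_cases hmn : m = n
  · simp [hmn]
  · rw [if_neg hmn, if_neg (by omega)]; simp

theorem integral_sin_mul_cos (m n : ℕ) :
    ∫ t in (0 : ℝ)..(2 * Real.pi), Real.sin ((m + 1 : ℕ) * t) * Real.cos ((n + 1 : ℕ) * t)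
      = 0 := by
  have h : ∀ t : ℝ, Real.sin ((m + 1 : ℕ) * t) * Real.cos ((n + 1 : ℕ) * t)
      = (1 / 2) * (Real.sin (((m : ℤ) - n : ℤ) * t) + Real.sin (((m : ℤ) + n + 2 : ℤ) * t)) := by
    intro t
    have h1 : (((m : ℤ) - n : ℤ) : ℝ) * t = (m + 1 : ℕ) * t - (n + 1 : ℕ) * t := by
      push_cast; ring
    have h2 : (((m : ℤ) + n + 2 : ℤ) : ℝ) * t = (m + 1 : ℕ) * t + (n + 1 : ℕ) * t := by
      push_cast; ring
    rw [h1, h2, Real.sin_sub, Real.sin_add]; ring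
  simp_rw [h]
  rw [intervalIntegral.integral_const_mul, intervalIntegral.integral_add
    (Continuous.intervalIntegrable (by fun_prop) _ _)
    (Continuous.intervalIntegrable (by fun_prop) _ _), integral_sin_int_mul, integral_sin_int_mul]
  simp

theorem TrigPoly.integral_eval_mul {N : ℕ} (p : TrigPoly N) (u : ℝ → ℝ) (hu : Continuous u) :
    ∫ t in (0 : ℝ)..(2 * Real.pi), p.eval t * u t
      = p.1 * (∫ t in (0 : ℝ)..(2 * Real.pi), u t)
        + ∑ j : Fin N, p.2.1 j *
            (∫ t in (0 : ℝ)..(2 * Real.pi), Real.cos (((j : ℕ) + 1 : ℕ) * t) * u t)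
        + ∑ j : Fin N, p.2.2 j *
            (∫ t in (0 : ℝ)..(2 * Real.pi), Real.sin (((j : ℕ) + 1 : ℕ) * t) * u t) := by
  simp only [TrigPoly.eval, add_mul, Finset.sum_mul, mul_assoc]
  rw [intervalIntegral.integral_add (Continuous.intervalIntegrable (by fun_prop) _ _)
    (Continuous.intervalIntegrable (by fun_prop) _ _),
    intervalIntegral.integral_add (Continuous.intervalIntegrable (by fun_prop) _ _)
    (Continuous.intervalIntegrable (by fun_prop) _ _),
    intervalIntegral.integral_finsetSum
      (fun i _ => Continuous.intervalIntegrable (by fun_prop) _ _),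
    intervalIntegral.integral_finsetSum
      (fun i _ => Continuous.intervalIntegrable (by fun_prop) _ _)]
  simp only [intervalIntegral.integral_const_mul]

theorem TrigPoly.integral_eval {N : ℕ} (p : TrigPoly N) :
    ∫ t in (0 : ℝ)..(2 * Real.pi), p.eval t = 2 * Real.pi * p.1 := by
  have hc : ∀ j : ℕ, ∫ t in (0 : ℝ)..(2 * Real.pi), Real.cos ((j + 1 : ℕ) * t) = 0 := by
    intro j
    have := integral_cos_int_mul ((j : ℤ) + 1)
    rw [if_neg (by omega)] at this
    simpa using this
  have hs : ∀ j : ℕ, ∫ t in (0 : ℝ)..(2 * Real.pi), Real.sin ((j + 1 : ℕ) * t) = 0 := by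
    intro j
    simpa using integral_sin_int_mul ((j : ℤ) + 1)
  have h := p.integral_eval_mul (fun _ => 1) continuous_const
  simp only [mul_one, hc, hs] at h
  rw [h]
  simp
  ring

theorem TrigPoly.integral_eval_mul_eval {N : ℕ} (p q : TrigPoly N) :
    ∫ t in (0 : ℝ)..(2 * Real.pi), p.eval t * q.eval t
      = Real.pi * (2 * (p.1 * q.1) + ∑ j, (p.2.1 j * q.2.1 j + p.2.2 j * q.2.2 j)) := by
  have hc : ∀ k : Fin N, ∫ t in (0 : ℝ)..(2 * Real.pi),
      Real.cos (((k : ℕ) + 1 : ℕ) * t) * q.eval t = Real.pi * q.2.1 k := by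
    intro k
    have h := q.integral_eval_mul (fun t => Real.cos (((k : ℕ) + 1 : ℕ) * t)) (by fun_prop)
    have h0 := integral_cos_int_mul ((k : ℤ) + 1)
    rw [if_neg (by omega)] at h0
    have h0' : ∫ t in (0 : ℝ)..(2 * Real.pi), Real.cos (((k : ℕ) + 1 : ℕ) * t) = 0 := by
      simpa using h0
    simp only [integral_cos_mul_cos, integral_sin_mul_cos, h0', Fin.val_inj] at h
    simp only [mul_comm (Real.cos _) (q.eval _), h]
    simp [mul_comm]
  have hs : ∀ k : Fin N, ∫ t in (0 : ℝ)..(2 * Real.pi),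
      Real.sin (((k : ℕ) + 1 : ℕ) * t) * q.eval t = Real.pi * q.2.2 k := by
    intro k
    have h := q.integral_eval_mul (fun t => Real.sin (((k : ℕ) + 1 : ℕ) * t)) (by fun_prop)
    have h0' : ∫ t in (0 : ℝ)..(2 * Real.pi), Real.sin (((k : ℕ) + 1 : ℕ) * t) = 0 := by
      simpa using integral_sin_int_mul ((k : ℤ) + 1)
    have h1 : ∀ j : Fin N, ∫ t in (0 : ℝ)..(2 * Real.pi),
        Real.cos (((j : ℕ) + 1 : ℕ) * t) * Real.sin (((k : ℕ) + 1 : ℕ) * t) = 0 := by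
      intro j
      simp only [mul_comm (Real.cos _) (Real.sin _)]
      exact integral_sin_mul_cos _ _
    simp only [integral_sin_mul_sin, h1, h0', Fin.val_inj] at h
    simp only [mul_comm (Real.sin _) (q.eval _), h]
    simp [mul_comm]
  rw [p.integral_eval_mul _ q.continuous_eval, q.integral_eval]
  simp only [hc, hs]
  rw [mul_add, Finset.mul_sum, add_assoc, ← Finset.sum_add_distrib]
  congr 1
  · ring
  · exact Finset.sum_congr rfl (fun j _ => by ring)

namespace TrigCurve

variable {N : ℕ}

/-- The dot product in terms of the coefficients. -/
theorem dot_eq (f g : TrigCurve N) :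
    dot f g = 2 * (f.xPoly.1 * g.xPoly.1 + f.yPoly.1 * g.yPoly.1)
      + ∑ j, (f.xPoly.2.1 j * g.xPoly.2.1 j + f.xPoly.2.2 j * g.xPoly.2.2 j
          + f.yPoly.2.1 j * g.yPoly.2.1 j + f.yPoly.2.2 j * g.yPoly.2.2 j) := by
  unfold dot x y
  rw [intervalIntegral.integral_add
    ((f.xPoly.continuous_eval.fun_mul g.xPoly.continuous_eval).intervalIntegrable _ _)
    ((f.yPoly.continuous_eval.fun_mul g.yPoly.continuous_eval).intervalIntegrable _ _),
    TrigPoly.integral_eval_mul_eval, TrigPoly.integral_eval_mul_eval, ← mul_add, ← mul_assoc,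
    one_div_mul_cancel Real.pi_ne_zero, one_mul]
  simp only [Finset.sum_add_distrib]
  ring

theorem dot_self_nonneg (f : TrigCurve N) : 0 ≤ dot f f := by
  rw [dot_eq]
  have : 0 ≤ ∑ j, (f.xPoly.2.1 j * f.xPoly.2.1 j + f.xPoly.2.2 j * f.xPoly.2.2 j
      + f.yPoly.2.1 j * f.yPoly.2.1 j + f.yPoly.2.2 j * f.yPoly.2.2 j) :=
    Finset.sum_nonneg fun j _ => by
      linarith [mul_self_nonneg (f.xPoly.2.1 j), mul_self_nonneg (f.xPoly.2.2 j),
        mul_self_nonneg (f.yPoly.2.1 j), mul_self_nonneg (f.yPoly.2.2 j)]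
  nlinarith [mul_self_nonneg f.xPoly.1, mul_self_nonneg f.yPoly.1]

theorem eq_zero_of_dot_self (f : TrigCurve N) (h : dot f f = 0) : f = 0 := by
  rw [dot_eq] at h
  have hnn : ∀ j ∈ (Finset.univ : Finset (Fin N)),
      0 ≤ f.xPoly.2.1 j * f.xPoly.2.1 j + f.xPoly.2.2 j * f.xPoly.2.2 j
        + f.yPoly.2.1 j * f.yPoly.2.1 j + f.yPoly.2.2 j * f.yPoly.2.2 j := fun j _ => by
      linarith [mul_self_nonneg (f.xPoly.2.1 j), mul_self_nonneg (f.xPoly.2.2 j),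
        mul_self_nonneg (f.yPoly.2.1 j), mul_self_nonneg (f.yPoly.2.2 j)]
  have hs := Finset.sum_nonneg hnn
  have h1 := mul_self_nonneg f.xPoly.1
  have h2 := mul_self_nonneg f.yPoly.1
  have hz := (Finset.sum_eq_zero_iff_of_nonneg hnn).1 (by linarith)
  have key : ∀ j, f.xPoly.2.1 j = 0 ∧ f.xPoly.2.2 j = 0 ∧ f.yPoly.2.1 j = 0 ∧ f.yPoly.2.2 j = 0 := by
    intro j
    have hj := hz j (Finset.mem_univ j)
    have e1 := mul_self_nonneg (f.xPoly.2.1 j)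
    have e2 := mul_self_nonneg (f.xPoly.2.2 j)
    have e3 := mul_self_nonneg (f.yPoly.2.1 j)
    have e4 := mul_self_nonneg (f.yPoly.2.2 j)
    refine ⟨?_, ?_, ?_, ?_⟩ <;> exact mul_self_eq_zero.1 (by linarith)
  refine TrigCurve.ext (Prod.ext ?_ (Prod.ext ?_ ?_)) (Prod.ext ?_ (Prod.ext ?_ ?_))
  · exact mul_self_eq_zero.1 (by linarith)
  · exact funext fun j => (key j).1
  · exact funext fun j => (key j).2.1
  · exact mul_self_eq_zero.1 (by linarith)
  · exact funext fun j => (key j).2.2.1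
  · exact funext fun j => (key j).2.2.2

/-- The `L₂` dot product makes the space of curves a Euclidean space. -/
@[reducible] def innerCore (N : ℕ) : InnerProductSpace.Core ℝ (TrigCurve N) where
  inner := dot
  conj_inner_symm f g := by
    simp only [conj_trivial, dot_eq, mul_comm]
  re_inner_nonneg f := by simpa using dot_self_nonneg f
  definite := eq_zero_of_dot_self
  add_left f g h := by
    simp only [dot_eq, xPoly_add, yPoly_add, Prod.fst_add, Prod.snd_add, Pi.add_apply, add_mul,
      Finset.sum_add_distrib]
    ring
  smul_left f g r := by
    simp only [dot_eq, xPoly_smul, yPoly_smul, Prod.smul_fst, Prod.smul_snd, Pi.smul_apply, smul_eq_mul,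
      conj_trivial, mul_add, Finset.mul_sum, mul_assoc, mul_left_comm]

instance : NormedAddCommGroup (TrigCurve N) := (innerCore N).toNormedAddCommGroup

instance : InnerProductSpace ℝ (TrigCurve N) := InnerProductSpace.ofCore (innerCore N).toCore

instance : MeasurableSpace (TrigCurve N) := borel (TrigCurve N)

instance : BorelSpace (TrigCurve N) := ⟨rfl⟩

theorem inner_eq_dot (f g : TrigCurve N) : inner ℝ f g = dot f g := rfl

/-- The intersection points in the plane of the curves `f` and `g`. -/
def intersectionPoints (f g : TrigCurve N) : Set (ℝ × ℝ) := range f.point ∩ range g.point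

/-- The pairs of parameters `(t, s)`, each running once over the circle, at which the curves
`f` and `g` meet. -/
def intersectionParameters (f g : TrigCurve N) : Set (ℝ × ℝ) :=
  {q | q.1 ∈ Ico 0 (2 * Real.pi) ∧ q.2 ∈ Ico 0 (2 * Real.pi) ∧ f.point q.1 = g.point q.2}

/-- The space of pairs of curves both of which lie in the ball of radius `R` centred at the
origin. The measure `volume` on `TrigCurve N × TrigCurve N` is the product of the two Euclidean
volumes. -/
def ballPairs (N : ℕ) (R : ℝ) : Set (TrigCurve N × TrigCurve N) :=
  Metric.closedBall 0 R ×ˢ Metric.closedBall 0 R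

/-- The set of pairs in `ballPairs N R` whose curves have exactly `i` intersection points. -/
def pairsMeeting (N : ℕ) (R : ℝ) (i : ℕ) : Set (TrigCurve N × TrigCurve N) :=
  {p ∈ ballPairs N R | (intersectionPoints p.1 p.2).encard = i}

/-- The relative volume of `pairsMeeting N R i` in `ballPairs N R`. -/
def relativeVolume (N : ℕ) (R : ℝ) (i : ℕ) : ℝ :=
  volume.real (pairsMeeting N R i) / volume.real (ballPairs N R)

end TrigCurve

end

/-! Identify the plane with `ℂ` and write a curve as `c + A_t w`, where `c` is the constant term and
`w ∈ ℂ^(2N)` collects the other coefficients. Its squared norm is `2|c|² + ‖w‖²` and its velocity is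
`B_t w`. Curves `(c, w)` and `(c', w')` meet at times `(t, s)` exactly when `c = c' + A_s w' - A_t
w`. Hence the map `meetAt`, sending `(t, s, w, c', w')` to the pair with this `c`, has as its fibres
the sets of intersection parameters, and the area formula turns the integral of the intersection
number into the integral of `|det|`. That determinant is, up to sign, the cross product of the two
velocities.

For fixed times the remaining integral does not depend on them, because `A A* = N`, `B A* = 0` and
`B B* = 1² + ⋯ + N²` at every time. Using the meeting point `z` as a variable decouples `w` from
`w'`; completing the square in each leaves `B w` unchanged, and homogeneity reduces the slices of
the balls to Gaussian integrals (`setLIntegral_slice`, `lintegral_jacobian_slice`). Integrating over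
`z` and over the square of times gives `lintegral_encard_meetings`; dividing by the volume of a
product of two ellipsoids gives the constant (`mean_value_eq`).

Points and parameters are equally many for almost all pairs, since the pairs in which one curve
passes through a double point of the other form a null set (`volume_throughDouble_eq_zero`): they
lie in the image of a map that ignores one coordinate. -/

noncomputable section

/-! ### The area formula in equal dimensions. -/

section AreaFormula

open Function

variable {E : Type*} [NormedAddCommGroup E] [NormedSpace ℝ E] [FiniteDimensional ℝ E]
  [MeasurableSpace E] [BorelSpace E]

/-- A map whose derivative is invertible on `s` is injective on each of countably many disjoint
measurable pieces of `s`. -/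
theorem exists_partition_injOn_of_det_ne_zero [Nontrivial E] (f : E → E) (s : Set E)
    (f' : E → E →L[ℝ] E) (hf' : ∀ x ∈ s, HasFDerivWithinAt f (f' x) s x)
    (hdet : ∀ x ∈ s, (f' x).det ≠ 0) :
    ∃ t : ℕ → Set E, Pairwise (Disjoint on t) ∧ (∀ n, MeasurableSet (t n)) ∧
      s ⊆ ⋃ n, t n ∧ ∀ n, InjOn f (s ∩ t n) := by
  classical
  rcases s.eq_empty_or_nonempty with rfl | hne
  · exact ⟨fun _ => ∅, fun _ _ _ => by simp [Function.onFun], by simp, by simp, by simp⟩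
  let r : (E →L[ℝ] E) → NNReal := fun A =>
    if h : A.det ≠ 0 then
      ‖((A.toContinuousLinearEquivOfDetNeZero h).symm : E →L[ℝ] E)‖₊⁻¹ / 2 else 1
  have hpos : ∀ e : E ≃L[ℝ] E, 0 < ‖(e.symm : E →L[ℝ] E)‖₊ := fun e => e.nnnorm_symm_pos
  obtain ⟨t, A, h1, h2, h3, h4, h5⟩ :=
    exists_partition_approximatesLinearOn_of_hasFDerivWithinAt f s f' hf' r (fun A => by
      by_cases h : A.det ≠ 0
      · simp only [r, h, ne_eq, not_false_eq_true, dite_true]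
        have := hpos (A.toContinuousLinearEquivOfDetNeZero h)
        positivity
      · simp only [r, h, dite_false]; exact one_ne_zero)
  refine ⟨t, h1, h2, h3, fun n => ?_⟩
  obtain ⟨y, hy, hA⟩ := h5 hne n
  have hd : (A n).det ≠ 0 := hA ▸ hdet y hy
  have h := h4 n
  simp only [r, hd, ne_eq, not_false_eq_true, dite_true] at h
  have h' : ApproximatesLinearOn f
      (((A n).toContinuousLinearEquivOfDetNeZero hd : E ≃L[ℝ] E) : E →L[ℝ] E) (s ∩ t n)
      (‖(((A n).toContinuousLinearEquivOfDetNeZero hd).symm : E →L[ℝ] E)‖₊⁻¹ / 2) := by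
    simpa using h
  refine h'.injOn (Or.inr ?_)
  exact NNReal.half_lt_self (inv_ne_zero (hpos _).ne')

/-- A piece on which `f` is injective contributes one point to the fibre if `y` lies in its image
and none otherwise; counting measure adds these up over the disjoint pieces. -/
theorem encard_fiber_eq_tsum {f : E → E} {s : Set E} {t : ℕ → Set E}
    (h1 : Pairwise (Disjoint on t)) (h3 : s ⊆ ⋃ n, t n) (h4 : ∀ n, InjOn f (s ∩ t n)) (y : E) :
    (((s ∩ f ⁻¹' {y}).encard : ℕ∞) : ENNReal)
      = ∑' n, (f '' (s ∩ t n)).indicator (fun _ => 1) y := by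
  have hsub : ∀ n, ((s ∩ t n) ∩ f ⁻¹' {y}).Subsingleton := fun n a ha b hb =>
    h4 n ha.1 hb.1 (ha.2.trans (Eq.symm hb.2))
  have hU : s ∩ f ⁻¹' {y} = ⋃ n, ((s ∩ t n) ∩ f ⁻¹' {y}) := by
    rw [← iUnion_inter, ← inter_iUnion, inter_eq_left.2 h3]
  have hm : ∀ n, MeasurableSet ((s ∩ t n) ∩ f ⁻¹' {y}) := fun n => (hsub n).measurableSet
  rw [← Measure.count_apply (hU ▸ MeasurableSet.iUnion hm), hU,
    measure_iUnion (fun i j hij => (h1 hij).mono (fun x hx => hx.1.2) (fun x hx => hx.1.2)) hm]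
  congr 1
  ext n
  rw [Measure.count_apply (hm n)]
  by_cases hy : y ∈ f '' (s ∩ t n)
  · rw [indicator_of_mem hy]
    obtain ⟨x, hx, hxy⟩ := hy
    rw [(hsub n).eq_singleton_of_mem ⟨hx, hxy⟩]
    simp
  · rw [indicator_of_notMem hy]
    have : (s ∩ t n) ∩ f ⁻¹' {y} = ∅ := by
      ext x
      simp only [mem_inter_iff, mem_preimage, mem_singleton_iff, mem_empty_iff_false, iff_false]
      exact fun hx => hy ⟨x, hx.1, hx.2⟩
    rw [this]
    simp

variable (μ : Measure E) [μ.IsAddHaarMeasure]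

/-- The area formula between spaces of the same dimension. -/
theorem aemeasurable_encard_fiber_and_lintegral [Nontrivial E] {f : E → E} {s : Set E}
    (hs : MeasurableSet s)
    {f' : E → E →L[ℝ] E} (hf' : ∀ x ∈ s, HasFDerivWithinAt f (f' x) s x)
    (hdet : Measurable fun x => (f' x).det) :
    AEMeasurable (fun y => (((s ∩ f ⁻¹' {y}).encard : ℕ∞) : ENNReal)) μ ∧
    ∫⁻ y, (((s ∩ f ⁻¹' {y}).encard : ℕ∞) : ENNReal) ∂μ
      = ∫⁻ x in s, ENNReal.ofReal |(f' x).det| ∂μ := by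
  set r : Set E := s ∩ {x | (f' x).det ≠ 0} with hr
  set z : Set E := s ∩ {x | (f' x).det = 0} with hz
  have mz : MeasurableSet {x | (f' x).det = 0} := hdet (measurableSet_singleton 0)
  have mr : MeasurableSet r := hs.inter mz.compl
  have hrs : r ⊆ s := inter_subset_left
  obtain ⟨t, h1, h2, h3, h4⟩ := exists_partition_injOn_of_det_ne_zero f r f'
    (fun x hx => (hf' x (hrs hx)).mono hrs) (fun x hx => hx.2)
  have hd : ∀ n, ∀ x ∈ r ∩ t n, HasFDerivWithinAt f (f' x) (r ∩ t n) x := fun n x hx =>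
    (hf' x (hrs hx.1)).mono (inter_subset_left.trans hrs)
  have mi : ∀ n, MeasurableSet (f '' (r ∩ t n)) := fun n =>
    measurable_image_of_fderivWithin (mr.inter (h2 n)) (hd n) (h4 n)
  -- Sard: critical values are null, so for almost every `y` only the regular part `r` contributes
  -- to the fibre, and there the injective pieces are available.
  have hnull : μ (f '' z) = 0 :=
    addHaar_image_eq_zero_of_det_fderivWithin_eq_zero μ
      (fun x hx => (hf' x hx.1).mono inter_subset_left) (fun x hx => hx.2)
  have hae : (fun y => (((s ∩ f ⁻¹' {y}).encard : ℕ∞) : ENNReal)) =ᵐ[μ]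
      fun y => ∑' n, (f '' (r ∩ t n)).indicator (fun _ => (1 : ENNReal)) y := by
    filter_upwards [measure_eq_zero_iff_ae_notMem.1 hnull] with y hy
    rw [← encard_fiber_eq_tsum h1 h3 h4 y]
    congr 2
    ext x
    refine ⟨fun hx => ⟨⟨hx.1, fun h0 => hy ⟨x, ⟨hx.1, h0⟩, hx.2⟩⟩, hx.2⟩,
      fun hx => ⟨hrs hx.1, hx.2⟩⟩
  have hmeas : ∀ n, Measurable ((f '' (r ∩ t n)).indicator (fun _ => (1 : ENNReal))) :=
    fun n => measurable_const.indicator (mi n)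
  refine ⟨⟨_, Measurable.tsum hmeas, hae⟩, ?_⟩
  rw [lintegral_congr_ae hae, lintegral_tsum fun n => (hmeas n).aemeasurable]
  have hrU : r = ⋃ n, r ∩ t n := by rw [← inter_iUnion, inter_eq_left.2 h3]
  have hpart : ∫⁻ x in r, ENNReal.ofReal |(f' x).det| ∂μ
      = ∑' n, ∫⁻ x in r ∩ t n, ENNReal.ofReal |(f' x).det| ∂μ := by
    conv_lhs => rw [hrU]
    exact lintegral_iUnion (fun n => mr.inter (h2 n))
      (fun i j hij => (h1 hij).mono inter_subset_right inter_subset_right) _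
  have hsplit : ∫⁻ x in s, ENNReal.ofReal |(f' x).det| ∂μ
      = ∫⁻ x in r, ENNReal.ofReal |(f' x).det| ∂μ := by
    rw [← lintegral_inter_add_sdiff _ s mz]
    rw [setLIntegral_congr_fun (g := fun _ => 0) (hs.inter mz) (fun x hx => by
      have : (f' x).det = 0 := hx.2
      simp [this])]
    simp only [lintegral_zero, zero_add]
    rfl
  rw [hsplit, hpart]
  congr 1
  ext n
  rw [lintegral_indicator (mi n), lintegral_abs_det_fderiv_eq_addHaar_image μ (mr.inter (h2 n))
    (hd n) (h4 n)]
  simp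

end AreaFormula

/-! ### Gaussian integrals and sublevel integrals of homogeneous functions. -/

section Gaussian

open ENNReal (ofReal)
open RealInnerProductSpace

variable {V W F : Type*}
  [NormedAddCommGroup V] [InnerProductSpace ℝ V] [FiniteDimensional ℝ V]
  [MeasurableSpace V] [BorelSpace V]
  [NormedAddCommGroup W] [InnerProductSpace ℝ W] [FiniteDimensional ℝ W]
  [MeasurableSpace W] [BorelSpace W]
  [NormedAddCommGroup F] [InnerProductSpace ℝ F] [FiniteDimensional ℝ F]
  [MeasurableSpace F] [BorelSpace F]

theorem integrable_exp_neg_sq_norm : Integrable fun v : V => Real.exp (-‖v‖ ^ 2) := by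
  have h := GaussianFourier.integrable_cexp_neg_mul_sq_norm_add (b := 1) (by simp) 0 (0 : V)
  have := h.norm
  refine this.congr (Filter.Eventually.of_forall fun v => ?_)
  simp [Complex.norm_exp, ← Complex.ofReal_pow]

theorem integral_exp_neg_sq_norm :
    ∫ v : V, Real.exp (-‖v‖ ^ 2) = Real.pi ^ (Module.finrank ℝ V / 2 : ℝ) := by
  simpa using GaussianFourier.integral_rexp_neg_mul_sq_norm (V := V) one_pos

theorem lintegral_exp_neg_sq_norm :
    ∫⁻ v : V, ofReal (Real.exp (-‖v‖ ^ 2)) = ofReal (Real.pi ^ (Module.finrank ℝ V / 2 : ℝ)) := by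
  rw [← ofReal_integral_eq_lintegral_ofReal integrable_exp_neg_sq_norm
    (Filter.Eventually.of_forall fun v => (Real.exp_pos _).le), integral_exp_neg_sq_norm]

variable (V) in
/-- The measure with density `exp (-‖v‖²)`. -/
def gaussWeight : Measure V := volume.withDensity fun v => ofReal (Real.exp (-‖v‖ ^ 2))

theorem measurable_gaussDensity {U : Type*} [NormedAddCommGroup U] [MeasurableSpace U]
    [BorelSpace U] : Measurable fun v : U => ofReal (Real.exp (-‖v‖ ^ 2)) := by
  fun_prop

instance : IsFiniteMeasure (gaussWeight V) := by
  constructor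
  rw [gaussWeight, withDensity_apply _ MeasurableSet.univ, Measure.restrict_univ,
    lintegral_exp_neg_sq_norm]
  exact ENNReal.ofReal_lt_top

theorem charFun_gaussWeight (t : V) :
    charFun (gaussWeight V) t
      = (Real.pi : ℂ) ^ (Module.finrank ℝ V / 2 : ℂ) * Complex.exp (-(‖t‖ ^ 2 / 4 : ℝ)) := by
  rw [charFun_apply, gaussWeight, integral_withDensity_eq_integral_toReal_smul
    measurable_gaussDensity (Filter.Eventually.of_forall fun _ => ENNReal.ofReal_lt_top)]
  have h := GaussianFourier.integral_cexp_neg_mul_sq_norm_add (b := 1) (by simp) Complex.I t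
  simp only [div_one, Complex.I_sq, mul_one] at h
  have h1 : ∀ v : V, (ofReal (Real.exp (-‖v‖ ^ 2))).toReal • Complex.exp (⟪v, t⟫ * Complex.I)
      = Complex.exp (-1 * ‖v‖ ^ 2 + Complex.I * ⟪t, v⟫) := fun v => by
    rw [ENNReal.toReal_ofReal (Real.exp_pos _).le, Complex.exp_add, real_inner_comm,
      Complex.real_smul, mul_comm Complex.I]
    push_cast
    simp
  simp_rw [h1, h]
  push_cast
  ring_nf

theorem charFun_map_gaussWeight (T : V →L[ℝ] F) (z : F) :
    charFun ((gaussWeight V).map T) z = charFun (gaussWeight V) (T.adjoint z) := by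
  rw [charFun_apply, charFun_apply, integral_map (by fun_prop) (by fun_prop)]
  simp only [ContinuousLinearMap.adjoint_inner_right]

theorem lintegral_gaussWeight {G : V → ENNReal} (hG : Measurable G) :
    ∫⁻ v, G v ∂gaussWeight V = ∫⁻ v : V, ofReal (Real.exp (-‖v‖ ^ 2)) * G v :=
  lintegral_withDensity_eq_lintegral_mul _ measurable_gaussDensity hG

/-- The law of a linear map under the Gaussian weight depends only on the norms of its adjoint. -/
theorem lintegral_gauss_comp_eq (L : V →L[ℝ] F) (M : W →L[ℝ] F)
    (h : ∀ z, ‖L.adjoint z‖ = ‖M.adjoint z‖) {H : F → ENNReal} (hH : Measurable H) :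
    ofReal (Real.pi ^ (Module.finrank ℝ W / 2 : ℝ))
        * ∫⁻ v : V, ofReal (Real.exp (-‖v‖ ^ 2)) * H (L v)
      = ofReal (Real.pi ^ (Module.finrank ℝ V / 2 : ℝ))
        * ∫⁻ v : W, ofReal (Real.exp (-‖v‖ ^ 2)) * H (M v) := by
  -- The characteristic function of the image of the weight under `L` is a constant times `exp (-‖L*
  -- z‖² / 4)`, so the images agree up to total mass; the crossed powers of `π` equalise the masses.
  have key : ofReal (Real.pi ^ (Module.finrank ℝ W / 2 : ℝ)) • (gaussWeight V).map L
      = ofReal (Real.pi ^ (Module.finrank ℝ V / 2 : ℝ)) • (gaussWeight W).map M := by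
    have : IsFiniteMeasure
        (ofReal (Real.pi ^ (Module.finrank ℝ W / 2 : ℝ)) • (gaussWeight V).map L) :=
      Measure.smul_finite _ ENNReal.ofReal_ne_top
    have : IsFiniteMeasure
        (ofReal (Real.pi ^ (Module.finrank ℝ V / 2 : ℝ)) • (gaussWeight W).map M) :=
      Measure.smul_finite _ ENNReal.ofReal_ne_top
    refine Measure.ext_of_charFun (funext fun z => ?_)
    have hc : ∀ d : ℕ, ((ofReal (Real.pi ^ (d / 2 : ℝ))).toReal : ℂ)
        = (Real.pi : ℂ) ^ (d / 2 : ℂ) := by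
      intro d
      rw [ENNReal.toReal_ofReal (by positivity), Complex.ofReal_cpow Real.pi_pos.le]
      push_cast
      rfl
    rw [charFun_apply, charFun_apply, integral_smul_measure, integral_smul_measure,
      ← charFun_apply, ← charFun_apply, charFun_map_gaussWeight, charFun_map_gaussWeight, charFun_gaussWeight, charFun_gaussWeight, h,
      Complex.real_smul, Complex.real_smul, hc, hc]
    ring
  have := congrArg (fun μ => ∫⁻ z, H z ∂μ) key
  simp only [lintegral_smul_measure, smul_eq_mul] at this
  rw [lintegral_map hH (by fun_prop), lintegral_map hH (by fun_prop), lintegral_gaussWeight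
    (G := fun v => H (L v)) (hH.comp L.continuous.measurable), lintegral_gaussWeight
    (G := fun v => H (M v)) (hH.comp M.continuous.measurable)] at this
  exact this

theorem lintegral_gauss_abs : ∫⁻ x : ℝ, ofReal (Real.exp (-‖x‖ ^ 2)) * ofReal |x| = 1 := by
  have h := integral_rpow_mul_exp_neg_rpow (p := 2) (q := 1) two_pos (by norm_num)
  have hi := integrableOn_rpow_mul_exp_neg_rpow (p := 2) (s := 1) (by norm_num) (by norm_num)
  have h1 : ∫⁻ x in Ioi (0 : ℝ), ofReal (Real.exp (-‖x‖ ^ 2)) * ofReal |x| = ofReal (1 / 2) := by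
    norm_num at h
    rw [← h, ofReal_integral_eq_lintegral_ofReal (by simpa [IntegrableOn] using hi)]
    · refine setLIntegral_congr_fun measurableSet_Ioi fun x hx => ?_
      have hx : 0 < x := hx
      rw [← ENNReal.ofReal_mul (by positivity), abs_of_pos hx, Real.norm_eq_abs, abs_of_pos hx,
        mul_comm]
    · exact (ae_restrict_iff' measurableSet_Ioi).2 (Filter.Eventually.of_forall fun x hx => by
        have hx : 0 < x := hx
        simp only [Pi.zero_apply]; positivity)
  have h2 : ∫⁻ x in Iic (0 : ℝ), ofReal (Real.exp (-‖x‖ ^ 2)) * ofReal |x| = ofReal (1 / 2) := by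
    rw [← h1, ← setLIntegral_congr Iio_ae_eq_Iic]
    rw [← (Measure.measurePreserving_neg (volume : Measure ℝ)).setLIntegral_comp_preimage_emb
      (MeasurableEquiv.neg ℝ).measurableEmbedding]
    simp
  rw [← lintegral_add_compl _ measurableSet_Ioi, compl_Ioi, h1, h2, ← ENNReal.ofReal_add] <;>
    norm_num

theorem lintegral_gauss_norm_complex :
    ∫⁻ x : ℂ, ofReal (Real.exp (-‖x‖ ^ 2)) * ofReal ‖x‖
      = ofReal (Real.pi * √Real.pi / 2) := by
  have h := Complex.integral_rpow_mul_exp_neg_rpow (p := 2) (q := 1) (by norm_num) (by norm_num)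
  have hg : Real.Gamma ((1 + 2) / 2) = √Real.pi / 2 := by
    have := Real.Gamma_nat_add_half 1
    norm_num at this ⊢
    linarith
  rw [hg] at h
  have hval : Real.pi * √Real.pi / 2 ≠ 0 := by positivity
  norm_num at h
  -- The integral of a nonintegrable function is `0` by convention, which the nonzero value in `h`
  -- excludes.
  have hint : Integrable fun x : ℂ => ‖x‖ * Real.exp (-‖x‖ ^ 2) := by
    by_contra hn
    rw [integral_undef hn] at h
    apply hval
    rw [h]; ring
  simp_rw [← ENNReal.ofReal_mul (Real.exp_pos _).le, mul_comm (Real.exp _)]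
  rw [← ofReal_integral_eq_lintegral_ofReal hint
    (Filter.Eventually.of_forall fun v => by positivity), h]
  congr 1
  ring

/-- If the sublevel integrals of `H` grow like a power, their Laplace transform is a Gamma
value. -/
theorem lintegral_exp_neg_mul_eq_of_sublevel {X : Type*} [MeasurableSpace X] {ν : Measure X}
    [SFinite ν] {q : X → ℝ} (hq : Measurable q) (hq0 : ∀ x, 0 ≤ q x) {H : X → ENNReal}
    (hH : Measurable H) {K : ENNReal} {a : ℝ} (ha : 0 ≤ a)
    (h : ∀ s : ℝ, 0 < s → ∫⁻ x in {x | q x ≤ s}, H x ∂ν = K * ofReal (s ^ a)) :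
    ∫⁻ x, ofReal (Real.exp (-q x)) * H x ∂ν = K * ofReal (Real.Gamma (a + 1)) := by
  have hset : MeasurableSet {p : X × ℝ | q p.1 ≤ p.2} :=
    measurableSet_le (hq.comp measurable_fst) measurable_snd
  -- Layer cake: `exp (-q)` is the integral of `exp (-s)` over `s ≥ q`. Exchanging the integrals
  -- leaves sublevel integrals weighted by `exp (-s)`, hence a Gamma integral.
  have e1 : ∀ x, ofReal (Real.exp (-q x))
      = ∫⁻ s in Ioi (0 : ℝ), {p : X × ℝ | q p.1 ≤ p.2}.indicator
          (fun p => ofReal (Real.exp (-p.2))) (x, s) := by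
    intro x
    rw [← integral_exp_neg_Ioi, ofReal_integral_eq_lintegral_ofReal (integrableOn_exp_neg_Ioi _)
      (Filter.Eventually.of_forall fun s => (Real.exp_pos _).le), setLIntegral_congr Ioi_ae_eq_Ici,
      setLIntegral_congr (Ioi_ae_eq_Ici (a := (0 : ℝ)))]
    have : ∀ s, {p : X × ℝ | q p.1 ≤ p.2}.indicator (fun p => ofReal (Real.exp (-p.2))) (x, s)
        = (Ici (q x)).indicator (fun s => ofReal (Real.exp (-s))) s := fun s => by
      simp [indicator]
    simp_rw [this]
    rw [lintegral_indicator measurableSet_Ici, Measure.restrict_restrict measurableSet_Ici,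
      inter_eq_left.2 (Ici_subset_Ici.2 (hq0 x))]
  have hmeas : Measurable fun p : X × ℝ =>
      {p : X × ℝ | q p.1 ≤ p.2}.indicator (fun p => ofReal (Real.exp (-p.2))) p * H p.1 :=
    (Measurable.indicator (by fun_prop) hset).mul (hH.comp measurable_fst)
  calc ∫⁻ x, ofReal (Real.exp (-q x)) * H x ∂ν
      = ∫⁻ x, ∫⁻ s in Ioi (0 : ℝ), {p : X × ℝ | q p.1 ≤ p.2}.indicator
          (fun p => ofReal (Real.exp (-p.2))) (x, s) * H x ∂volume ∂ν := by
        refine lintegral_congr fun x => ?_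
        rw [e1, lintegral_mul_const]
        exact (Measurable.indicator (by fun_prop) hset).comp measurable_prodMk_left
    _ = ∫⁻ s in Ioi (0 : ℝ), (∫⁻ x, {p : X × ℝ | q p.1 ≤ p.2}.indicator
          (fun p => ofReal (Real.exp (-p.2))) (x, s) * H x ∂ν) ∂volume :=
        lintegral_lintegral_swap hmeas.aemeasurable
    _ = ∫⁻ s in Ioi (0 : ℝ), K * ofReal (Real.exp (-s) * s ^ (a + 1 - 1)) := by
        refine setLIntegral_congr_fun measurableSet_Ioi fun s hs => ?_
        have hs : 0 < s := hs
        have : ∀ x, {p : X × ℝ | q p.1 ≤ p.2}.indicator (fun p => ofReal (Real.exp (-p.2))) (x, s)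
            * H x = ofReal (Real.exp (-s)) * {x | q x ≤ s}.indicator H x := fun x => by
          by_cases hx : q x ≤ s <;> simp [indicator, hx]
        simp_rw [this]
        rw [lintegral_const_mul _ (hH.indicator (measurableSet_le hq measurable_const)),
          lintegral_indicator (measurableSet_le hq measurable_const), h s hs,
          ENNReal.ofReal_mul (Real.exp_pos _).le, add_sub_cancel_right]
        ring
    _ = K * ofReal (Real.Gamma (a + 1)) := by
        rw [lintegral_const_mul _ (by fun_prop), Real.Gamma_eq_integral (by linarith),
          ofReal_integral_eq_lintegral_ofReal (Real.GammaIntegral_convergent (by linarith))]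
        exact (ae_restrict_iff' measurableSet_Ioi).2 (Filter.Eventually.of_forall fun x hx => by
          have hx : 0 < x := hx
          simp only [Pi.zero_apply]; positivity)

/-- Sublevel integrals of homogeneous functions through Gaussian-type integrals. -/
theorem setLIntegral_sublevel_mul_Gamma {X : Type*} [NormedAddCommGroup X] [NormedSpace ℝ X]
    [FiniteDimensional ℝ X] [MeasurableSpace X] [BorelSpace X] (μ : Measure X)
    [μ.IsAddHaarMeasure] {q : X → ℝ} (hq : Measurable q) (hq0 : ∀ x, 0 ≤ q x)
    (hqs : ∀ (c : ℝ) x, q (c • x) = c ^ 2 * q x) {H : X → ENNReal} (hH : Measurable H)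
    (p : ℕ) (hHs : ∀ (c : ℝ) x, 0 < c → H (c • x) = ofReal (c ^ p) * H x) {s : ℝ} (hs : 0 < s) :
    (∫⁻ x in {x | q x ≤ s}, H x ∂μ) * ofReal (Real.Gamma ((Module.finrank ℝ X + p) / 2 + 1))
      = ofReal (s ^ ((Module.finrank ℝ X + p) / 2 : ℝ))
        * ∫⁻ x, ofReal (Real.exp (-q x)) * H x ∂μ := by
  set d := Module.finrank ℝ X
  -- Rescaling by `√s` multiplies `q` by `s`, the measure by `s ^ (d / 2)` and `H` by `s ^ (p / 2)`.
  have key : ∀ s : ℝ, 0 < s → ∫⁻ x in {x | q x ≤ s}, H x ∂μ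
      = (∫⁻ x in {x | q x ≤ 1}, H x ∂μ) * ofReal (s ^ ((d + p) / 2 : ℝ)) := by
    intro s hs
    set c := √s
    have hc : 0 < c := Real.sqrt_pos.2 hs
    have hc2 : c ^ 2 = s := Real.sq_sqrt hs.le
    have hms : ∀ s, MeasurableSet {x | q x ≤ s} := fun s => measurableSet_le hq measurable_const
    have hmap := Measure.map_addHaar_smul μ hc.ne'
    have h1 : ∫⁻ x, {x | q x ≤ s}.indicator H (c • x) ∂μ
        = ofReal (c ^ p) * ∫⁻ x in {x | q x ≤ 1}, H x ∂μ := by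
      rw [← lintegral_indicator (hms 1), ← lintegral_const_mul _ (hH.indicator (hms 1))]
      refine lintegral_congr fun x => ?_
      have : q (c • x) ≤ s ↔ q x ≤ 1 := by
        rw [hqs, hc2]
        exact ⟨fun h => le_of_mul_le_mul_left (by linarith) hs, fun h => by nlinarith⟩
      by_cases hx : q x ≤ 1 <;> simp [indicator, this, hx, hHs c x hc]
    have h2 : ∫⁻ x, {x | q x ≤ s}.indicator H (c • x) ∂μ
        = ofReal |(c ^ d)⁻¹| * ∫⁻ x in {x | q x ≤ s}, H x ∂μ := by
      rw [← lintegral_map (hH.indicator (hms s)) (measurable_const_smul c), hmap,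
        lintegral_smul_measure, lintegral_indicator (hms s), smul_eq_mul]
    have h3 := h2.symm.trans h1
    have h4 : ofReal (s ^ ((d + p) / 2 : ℝ)) = ofReal (c ^ d) * ofReal (c ^ p) := by
      rw [← ENNReal.ofReal_mul (by positivity), ← pow_add, ← hc2, ← Real.rpow_natCast c 2,
        ← Real.rpow_mul hc.le, ← Real.rpow_natCast]
      congr 2
      push_cast
      ring
    have h5 : ofReal (c ^ d) * ofReal |(c ^ d)⁻¹| = 1 := by
      rw [abs_of_pos (by positivity), ← ENNReal.ofReal_mul (by positivity),
        mul_inv_cancel₀ (by positivity), ENNReal.ofReal_one]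
    rw [h4, mul_comm, mul_assoc, ← h3, ← mul_assoc, h5, one_mul]
  rw [lintegral_exp_neg_mul_eq_of_sublevel hq hq0 hH (by positivity) key, key s hs]
  ring

end Gaussian

/-! ### Slices of the balls at fixed intersection times. -/

section Slices

open ENNReal (ofReal)
open RealInnerProductSpace ComplexConjugate

variable {V : Type*} [NormedAddCommGroup V] [InnerProductSpace ℝ V] [FiniteDimensional ℝ V]

theorem lintegral_exp_neg_mul_sq_norm_complex {b : ℝ} (hb : 0 < b) :
    ∫⁻ z : ℂ, ofReal (Real.exp (-(b * ‖z‖ ^ 2))) = ofReal (Real.pi / b) := by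
  have h := GaussianFourier.integral_rexp_neg_mul_sq_norm (V := ℂ) hb
  rw [Complex.finrank_real_complex] at h
  norm_num at h
  have hint : Integrable fun z : ℂ => Real.exp (-(b * ‖z‖ ^ 2)) := by
    by_contra hn
    rw [integral_undef hn] at h
    have : Real.pi / b ≠ 0 := by have := Real.pi_pos; positivity
    exact this h.symm
  rw [← h, ofReal_integral_eq_lintegral_ofReal hint
    (Filter.Eventually.of_forall fun v => (Real.exp_pos _).le)]

/-- An exponent of at least two flattens the kink at the origin. This supplies the radial primitive
of a truncated power. -/
theorem hasDerivAt_max_zero_pow (n : ℕ) (x : ℝ) :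
    HasDerivAt (fun x : ℝ => max x 0 ^ (n + 2)) ((n + 2) * max x 0 ^ (n + 1)) x := by
  rcases lt_trichotomy x 0 with h | h | h
  · have : (fun x : ℝ => max x 0 ^ (n + 2)) =ᶠ[nhds x] fun _ => 0 := by
      filter_upwards [eventually_lt_nhds h] with y hy
      simp [max_eq_right hy.le]
    rw [max_eq_right h.le]
    simpa using (hasDerivAt_const x (0 : ℝ)).congr_of_eventuallyEq this
  · subst h
    rw [max_self, hasDerivAt_iff_isLittleO]
    simp only [max_self, ne_eq, Nat.add_eq_zero_iff, OfNat.ofNat_ne_zero, and_false,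
      not_false_eq_true, zero_pow, one_ne_zero, mul_zero, smul_zero, sub_zero]
    have h1 : (fun x : ℝ => max x 0 ^ (n + 2)) =O[nhds 0] fun x => x ^ (n + 2) := by
      refine Asymptotics.isBigO_of_le _ fun x => ?_
      rw [norm_pow, norm_pow]
      gcongr
      rcases le_total x 0 with h | h <;> simp [h]
    exact h1.trans_isLittleO (by
      simpa using Asymptotics.isLittleO_pow_id (show 1 < n + 2 by omega))
  · have : (fun x : ℝ => max x 0 ^ (n + 2)) =ᶠ[nhds x] fun x => x ^ (n + 2) := by
      filter_upwards [eventually_gt_nhds h] with y hy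
      simp [max_eq_left hy.le]
    rw [max_eq_left h.le]
    refine ((hasDerivAt_pow (n + 2) x).congr_of_eventuallyEq this).congr_deriv ?_
    push_cast
    rfl

/-- The integral of `(ρ - b |z|²)₊ ^ (n + 1)` over the plane. -/
theorem lintegral_truncated_pow_complex {b ρ : ℝ} (hb : 0 < b) (hρ : 0 < ρ) (n : ℕ) :
    ∫⁻ z : ℂ, ofReal (max (ρ - b * ‖z‖ ^ 2) 0 ^ (n + 1))
      = ofReal (Real.pi / b * (ρ ^ (n + 2) / (n + 2))) := by
  set f : ℝ → ℝ := fun y => max (ρ - b * y ^ 2) 0 ^ (n + 1) with hf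
  have hfc : Continuous f := by fun_prop
  have hsupp : ∀ y : ℝ, √(ρ / b) < y → ρ - b * y ^ 2 ≤ 0 := fun y hy => by
    have h0 : ρ / b < y ^ 2 := (Real.sqrt_lt' (lt_of_le_of_lt (Real.sqrt_nonneg _) hy)).1 hy
    rw [div_lt_iff₀ hb] at h0
    linarith
  have hint : Integrable fun z : ℂ => f ‖z‖ := by
    refine Continuous.integrable_of_hasCompactSupport (by fun_prop)
      (HasCompactSupport.intro (isCompact_closedBall 0 √(ρ / b)) fun z hz => ?_)
    simp only [Metric.mem_closedBall, dist_zero_right, not_le] at hz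
    simp [hf, max_eq_right (hsupp _ hz)]
  -- In polar coordinates the radial integrand is `y * f y`; this primitive of it vanishes for large
  -- `y`, so only its value at `0` survives.
  have hd : ∀ y : ℝ, HasDerivAt
      (fun y : ℝ => -(max (ρ - b * y ^ 2) 0 ^ (n + 2)) / (2 * b * (n + 2))) (y * f y) y := fun y => by
    have h1 : HasDerivAt (fun y : ℝ => ρ - b * y ^ 2) (-(b * (2 * y))) y := by
      simpa using ((hasDerivAt_pow 2 y).const_mul b).const_sub ρ
    have h2 := ((hasDerivAt_max_zero_pow n (ρ - b * y ^ 2)).comp y h1).neg.div_const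
      (2 * b * (n + 2))
    refine h2.congr_deriv ?_
    simp only [hf]
    field_simp
  have hlim : Filter.Tendsto
      (fun y : ℝ => -(max (ρ - b * y ^ 2) 0 ^ (n + 2)) / (2 * b * (n + 2))) Filter.atTop
      (nhds 0) := by
    refine tendsto_const_nhds.congr' ?_
    filter_upwards [Filter.eventually_gt_atTop √(ρ / b)] with y hy
    simp [max_eq_right (hsupp _ hy)]
  have hI := integral_Ioi_of_hasDerivAt_of_nonneg' (a := 0) (fun y _ => hd y)
    (fun y hy => by have : 0 < y := hy; positivity) hlim
  have key := integral_fun_norm_addHaar (volume : Measure ℂ) f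
  rw [Complex.finrank_real_complex] at key
  simp only [Nat.add_one_sub_one, pow_one, smul_eq_mul, hI] at key
  rw [← ofReal_integral_eq_lintegral_ofReal hint
    (Filter.Eventually.of_forall fun v => by positivity), key]
  congr 1
  rw [Measure.real, Complex.volume_ball]
  simp [max_eq_left hρ.le]
  field_simp

variable {N : ℕ} {S : ℝ} {A B A' B' : V →L[ℝ] ℂ}

/-- Completing the square in `w`. The critical point of `2‖z - A w‖² + ‖w‖²` solves `w = 2 A* (z - A
w)`; with `A A* = N` the solution is `κ A* z` where `κ = 2 (1 - N κ)`, that is `κ = 2 / (2N + 1)`.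
-/
theorem sq_norm_shift (hA : ∀ z, A (A.adjoint z) = (N : ℝ) • z) (z : ℂ) (w : V) :
    2 * ‖z - A (w + (2 / (2 * N + 1) : ℝ) • A.adjoint z)‖ ^ 2
        + ‖w + (2 / (2 * N + 1) : ℝ) • A.adjoint z‖ ^ 2
      = 2 / (2 * N + 1) * ‖z‖ ^ 2 + (2 * ‖A w‖ ^ 2 + ‖w‖ ^ 2) := by
  have h1 : z - A (w + (2 / (2 * N + 1) : ℝ) • A.adjoint z)
      = (1 / (2 * N + 1) : ℝ) • z - A w := by
    rw [map_add, map_smul, hA, smul_smul]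
    have : z = (1 : ℝ) • z := (one_smul ℝ z).symm
    conv_lhs => rw [this]
    rw [smul_smul, mul_one, ← sub_sub, sub_right_comm, ← sub_smul]
    congr 2
    field_simp
    ring
  have h2 : ‖A.adjoint z‖ ^ 2 = N * ‖z‖ ^ 2 := by
    rw [← real_inner_self_eq_norm_sq, ContinuousLinearMap.adjoint_inner_left, hA,
      real_inner_smul_right, real_inner_self_eq_norm_sq]
  have h3 : ⟪w, A.adjoint z⟫ = ⟪z, A w⟫ := by
    rw [ContinuousLinearMap.adjoint_inner_right, real_inner_comm]
  rw [h1, @norm_sub_sq_real, @norm_add_sq_real, norm_smul, norm_smul, mul_pow, mul_pow, h2,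
    real_inner_smul_left, real_inner_smul_right, h3, Real.norm_eq_abs, Real.norm_eq_abs, sq_abs,
    sq_abs]
  field_simp
  ring

theorem norm_adjoint_of_comp_adjoint (hB : ∀ z, B (B.adjoint z) = S • z) (z : ℂ) :
    ‖B.adjoint z‖ = √S * ‖z‖ := by
  have h : ‖B.adjoint z‖ ^ 2 = S * ‖z‖ ^ 2 := by
    rw [← real_inner_self_eq_norm_sq, ContinuousLinearMap.adjoint_inner_left, hB,
      real_inner_smul_right, real_inner_self_eq_norm_sq]
  rw [← Real.sqrt_sq (norm_nonneg (B.adjoint z)), h, Real.sqrt_mul' _ (sq_nonneg _),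
    Real.sqrt_sq (norm_nonneg z)]

variable [MeasurableSpace V] [BorelSpace V]

/-- Gaussian integral over a slice in terms of the full Gaussian integral. -/
theorem lintegral_gauss_slice (hA : ∀ z, A (A.adjoint z) = (N : ℝ) • z)
    (hBA : ∀ z, B (A.adjoint z) = 0) {H : ℂ → ENNReal} (hH : Measurable H) :
    (∫⁻ w, ofReal (Real.exp (-(2 * ‖A w‖ ^ 2 + ‖w‖ ^ 2))) * H (B w))
        * ofReal (Real.pi / (2 / (2 * N + 1)))
      = ofReal (Real.pi / 2) * ∫⁻ w : V, ofReal (Real.exp (-‖w‖ ^ 2)) * H (B w) := by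
  have hHB : Measurable fun w => H (B w) := hH.comp B.continuous.measurable
  have m1 : Measurable fun w : V =>
      ofReal (Real.exp (-(2 * ‖A w‖ ^ 2 + ‖w‖ ^ 2))) * H (B w) :=
    Measurable.mul (by fun_prop) hHB
  have m2 : Measurable fun w : V => ofReal (Real.exp (-‖w‖ ^ 2)) * H (B w) :=
    Measurable.mul (by fun_prop) hHB
  have hm : Measurable fun p : ℂ × V =>
      ofReal (Real.exp (-(2 * ‖p.1 - A p.2‖ ^ 2 + ‖p.2‖ ^ 2))) * H (B p.2) :=
    Measurable.mul (by fun_prop) (hHB.comp measurable_snd)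
  rw [← lintegral_exp_neg_mul_sq_norm_complex (by positivity), mul_comm,
    ← lintegral_mul_const _ (by fun_prop),
    ← lintegral_exp_neg_mul_sq_norm_complex two_pos,
    ← lintegral_const_mul _ m2]
  -- One double integral in two orders. With `w` inside, completing the square separates `z` from
  -- `w` and leaves `B w` unchanged since `B A* = 0`; with `z` inside, translating by `A w` frees
  -- `z` from `A`.
  calc _ = ∫⁻ z : ℂ, ∫⁻ w : V,
        ofReal (Real.exp (-(2 * ‖z - A w‖ ^ 2 + ‖w‖ ^ 2))) * H (B w) := by
        refine lintegral_congr fun z => ?_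
        rw [← lintegral_const_mul _ m1, ← lintegral_add_right_eq_self (fun w : V =>
          ofReal (Real.exp (-(2 * ‖z - A w‖ ^ 2 + ‖w‖ ^ 2))) * H (B w)) ((2 / (2 * N + 1) : ℝ) • A.adjoint z)]
        refine lintegral_congr fun w => ?_
        rw [sq_norm_shift hA, map_add, map_smul, hBA, smul_zero, add_zero, ← mul_assoc,
          ← ENNReal.ofReal_mul (Real.exp_pos _).le, ← Real.exp_add, ← neg_add]
    _ = ∫⁻ w : V, ∫⁻ z : ℂ,
        ofReal (Real.exp (-(2 * ‖z - A w‖ ^ 2 + ‖w‖ ^ 2))) * H (B w) :=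
        lintegral_lintegral_swap hm.aemeasurable
    _ = _ := by
        refine lintegral_congr fun w => ?_
        rw [lintegral_mul_const _ (by fun_prop), ← mul_assoc]
        congr 1
        rw [lintegral_sub_right_eq_self (fun z : ℂ =>
          ofReal (Real.exp (-(2 * ‖z‖ ^ 2 + ‖w‖ ^ 2)))) (A w),
          ← lintegral_mul_const _ (by fun_prop)]
        refine lintegral_congr fun z => ?_
        rw [← ENNReal.ofReal_mul (Real.exp_pos _).le, ← Real.exp_add, neg_add]

/-- The integral of a homogeneous function over a slice of a ball. -/
theorem setLIntegral_slice (hV : Module.finrank ℝ V = 4 * N)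
    (hA : ∀ z, A (A.adjoint z) = (N : ℝ) • z)
    (hBA : ∀ z, B (A.adjoint z) = 0) {H : ℂ → ENNReal} (hH : Measurable H) (hH0 : H 0 = 0)
    (hHs : ∀ (c : ℝ) x, 0 < c → H (c • x) = ofReal c * H x) {g : ℝ} (hg : 0 ≤ g)
    (hG : ∫⁻ w : V, ofReal (Real.exp (-‖w‖ ^ 2)) * H (B w) = ofReal g) (ρ : ℝ) (z : ℂ) :
    ∫⁻ w in {w : V | 2 * ‖z - A w‖ ^ 2 + ‖w‖ ^ 2 ≤ ρ}, H (B w)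
      = ofReal (g / ((2 * N + 1) * Real.Gamma (2 * N + 3 / 2)))
        * ofReal (max (ρ - 2 / (2 * N + 1) * ‖z‖ ^ 2) 0 ^ (2 * N + 1 / 2 : ℝ)) := by
  have hHB : Measurable fun w => H (B w) := hH.comp B.continuous.measurable
  have hq : Measurable fun w : V => 2 * ‖A w‖ ^ 2 + ‖w‖ ^ 2 := by fun_prop
  have hms : MeasurableSet {w : V | 2 * ‖z - A w‖ ^ 2 + ‖w‖ ^ 2 ≤ ρ} :=
    measurableSet_le (by fun_prop) measurable_const
  set s := ρ - 2 / (2 * N + 1) * ‖z‖ ^ 2 with hs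
  have hΓ : 0 < Real.Gamma (2 * N + 3 / 2) := Real.Gamma_pos_of_pos (by positivity)
  have e1 : ∫⁻ w in {w : V | 2 * ‖z - A w‖ ^ 2 + ‖w‖ ^ 2 ≤ ρ}, H (B w)
      = ∫⁻ w in {w : V | 2 * ‖A w‖ ^ 2 + ‖w‖ ^ 2 ≤ s}, H (B w) := by
    rw [← lintegral_indicator hms, ← lintegral_indicator (measurableSet_le hq measurable_const),
      ← lintegral_add_right_eq_self _ ((2 / (2 * N + 1) : ℝ) • A.adjoint z)]
    refine lintegral_congr fun w => ?_
    simp only [indicator, mem_ofPred_eq, sq_norm_shift hA]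
    simp only [map_add, map_smul, hBA, smul_zero, add_zero, hs, le_sub_iff_add_le']
  rw [e1]
  -- At a level `s ≤ 0` the recentred ellipsoid contains at most the origin, where `H` vanishes. At
  -- a positive level the integrand is homogeneous of degree one in dimension `4N`, whence the
  -- exponent `(4N + 1) / 2`.
  rcases le_or_gt s 0 with h0 | h0
  · rw [max_eq_right h0, Real.zero_rpow (by positivity), ENNReal.ofReal_zero, mul_zero,
      setLIntegral_congr_fun (g := fun _ => 0) (measurableSet_le hq measurable_const)
      (fun w hw => ?_), lintegral_zero]
    have hw : 2 * ‖A w‖ ^ 2 + ‖w‖ ^ 2 ≤ s := hw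
    have : ‖w‖ ^ 2 ≤ 0 := by nlinarith [sq_nonneg ‖A w‖]
    have : w = 0 := by simpa using (sq_eq_zero_iff.1 (le_antisymm this (sq_nonneg _)))
    simp [this, hH0]
  · have key := setLIntegral_sublevel_mul_Gamma (volume : Measure V) hq (fun w => by positivity)
      (fun c w => by
        rw [map_smul, norm_smul, norm_smul, mul_pow, mul_pow, Real.norm_eq_abs, sq_abs]
        ring) hHB 1 (fun c w hc => by
        simp only [map_smul, hHs c _ hc, pow_one]) h0
    have hslice := lintegral_gauss_slice hA hBA hH
    rw [hG] at hslice
    rw [hV] at key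
    have ex : ((4 * N : ℕ) + (1 : ℕ) : ℝ) / 2 = 2 * N + 1 / 2 := by push_cast; ring
    rw [ex, show (2 * N + 1 / 2 + 1 : ℝ) = 2 * N + 3 / 2 by ring] at key
    have hc : ofReal (Real.Gamma (2 * N + 3 / 2)) * ofReal (Real.pi / (2 / (2 * N + 1))) ≠ 0 := by
      rw [← ENNReal.ofReal_mul hΓ.le]
      exact (ENNReal.ofReal_pos.2 (by have := Real.pi_pos; positivity)).ne'
    have hc' : ofReal (Real.Gamma (2 * N + 3 / 2)) * ofReal (Real.pi / (2 / (2 * N + 1))) ≠ ⊤ := by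
      finiteness
    have hcg : ofReal (g / ((2 * N + 1) * Real.Gamma (2 * N + 3 / 2)))
        * (ofReal (Real.Gamma (2 * N + 3 / 2)) * ofReal (Real.pi / (2 / (2 * N + 1))))
        = ofReal (Real.pi / 2) * ofReal g := by
      rw [← ENNReal.ofReal_mul hΓ.le, ← ENNReal.ofReal_mul (by positivity),
        ← ENNReal.ofReal_mul (by positivity)]
      congr 1
      generalize Real.Gamma (2 * N + 3 / 2) = Γ at hΓ ⊢
      field_simp
    refine (ENNReal.mul_left_inj hc hc').1 ?_
    rw [← mul_assoc, key, mul_assoc, hslice, max_eq_left h0.le, mul_right_comm, hcg, mul_comm]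

theorem lintegral_gauss_abs_im (hV : Module.finrank ℝ V = 4 * N)
    (hB : ∀ z, B (B.adjoint z) = S • z) (β : ℂ) :
    ∫⁻ w : V, ofReal (Real.exp (-‖w‖ ^ 2)) * ofReal |(conj (B w) * β).im|
      = ofReal (Real.pi ^ (2 * N) / √Real.pi * √S * ‖β‖) := by
  -- The cross product with `β` is the inner product with `-iβ`, so `T ∘ B` can be replaced by
  -- multiplication by `√S ‖β‖` on the line: the adjoints have equal norms.
  set T : ℂ →L[ℝ] ℝ := innerSL ℝ (-Complex.I * β)
  have hT : ∀ x, T x = (conj x * β).im := fun x => by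
    simp [T, Complex.inner]
    ring
  have hTa : ∀ r, ‖T.adjoint r‖ = ‖β‖ * ‖r‖ := fun r => by
    have : T.adjoint r = r • (-Complex.I * β) := by
      refine ext_inner_right ℝ fun x => ?_
      rw [ContinuousLinearMap.adjoint_inner_left, real_inner_smul_left]
      simp [T]
      ring
    rw [this, norm_smul]
    simp [mul_comm]
  have h := lintegral_gauss_comp_eq (T.comp B)
    ((√S * ‖β‖) • ContinuousLinearMap.id ℝ ℝ) (fun r => by
      rw [ContinuousLinearMap.adjoint_comp, ContinuousLinearMap.comp_apply,
        norm_adjoint_of_comp_adjoint hB, hTa, map_smulₛₗ]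
      simp [ContinuousLinearMap.adjoint_id, mul_assoc, abs_of_nonneg (Real.sqrt_nonneg S)]) (H := fun x => ofReal |x|) (by fun_prop)
  simp only [ContinuousLinearMap.comp_apply, hT, hV] at h
  have e : ∀ x : ℝ, ofReal (Real.exp (-‖x‖ ^ 2))
      * ofReal |((√S * ‖β‖) • ContinuousLinearMap.id ℝ ℝ) x|
      = ofReal (√S * ‖β‖) * (ofReal (Real.exp (-‖x‖ ^ 2)) * ofReal |x|) := fun x => by
    simp only [FunLike.coe_smul, Pi.smul_apply, ContinuousLinearMap.id_apply, smul_eq_mul, abs_mul]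
    rw [abs_of_nonneg (Real.sqrt_nonneg _), abs_of_nonneg (norm_nonneg _),
      ENNReal.ofReal_mul (by positivity), mul_left_comm]
  simp_rw [e] at h
  rw [lintegral_const_mul _ (by fun_prop), lintegral_gauss_abs, mul_one,
    ← ENNReal.ofReal_mul (by positivity), mul_comm] at h
  have hπ := Real.pi_pos
  have hr : (Real.pi ^ ((Module.finrank ℝ ℝ : ℝ) / 2)) = √Real.pi := by
    rw [Module.finrank_self, Real.sqrt_eq_rpow]; norm_num
  have hn : (Real.pi ^ (((4 * N : ℕ) : ℝ) / 2)) = Real.pi ^ (2 * N) := by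
    rw [← Real.rpow_natCast]; push_cast; congr 1; ring
  rw [hr, hn] at h
  rw [ENNReal.eq_div_iff (by simpa using hπ) ENNReal.ofReal_ne_top |>.2 ((mul_comm _ _).trans h),
    ← ENNReal.ofReal_div_of_pos (by positivity)]
  congr 1
  field_simp

theorem lintegral_gauss_norm (hV : Module.finrank ℝ V = 4 * N)
    (hB : ∀ z, B (B.adjoint z) = S • z) :
    ∫⁻ w : V, ofReal (Real.exp (-‖w‖ ^ 2)) * ofReal ‖B w‖
      = ofReal (Real.pi ^ (2 * N) * √S * √Real.pi / 2) := by
  have h := lintegral_gauss_comp_eq B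
    (√S • ContinuousLinearMap.id ℝ ℂ) (fun r => by
      rw [norm_adjoint_of_comp_adjoint hB, map_smulₛₗ]
      simp [ContinuousLinearMap.adjoint_id, abs_of_nonneg (Real.sqrt_nonneg S)]) (H := fun x => ofReal ‖x‖) (by fun_prop)
  have e : ∀ x : ℂ, ofReal (Real.exp (-‖x‖ ^ 2)) * ofReal ‖(√S • ContinuousLinearMap.id ℝ ℂ) x‖
      = ofReal √S * (ofReal (Real.exp (-‖x‖ ^ 2)) * ofReal ‖x‖) := fun x => by
    simp only [FunLike.coe_smul, Pi.smul_apply, ContinuousLinearMap.id_apply, norm_smul]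
    rw [Real.norm_of_nonneg (Real.sqrt_nonneg _), ENNReal.ofReal_mul (by positivity),
      mul_left_comm]
  simp_rw [e, hV] at h
  rw [lintegral_const_mul _ (by fun_prop), lintegral_gauss_norm_complex,
    ← ENNReal.ofReal_mul (by positivity), ← ENNReal.ofReal_mul (by positivity), mul_comm] at h
  have hπ := Real.pi_pos
  have hr : (Real.pi ^ ((Module.finrank ℝ ℂ : ℝ) / 2)) = Real.pi := by
    rw [Complex.finrank_real_complex]; norm_num
  have hn : (Real.pi ^ (((4 * N : ℕ) : ℝ) / 2)) = Real.pi ^ (2 * N) := by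
    rw [← Real.rpow_natCast]; push_cast; congr 1; ring
  rw [hr, hn] at h
  rw [ENNReal.eq_div_iff (by simpa using hπ) ENNReal.ofReal_ne_top |>.2 ((mul_comm _ _).trans h),
    ← ENNReal.ofReal_div_of_pos (by positivity)]
  congr 1
  field_simp

/-- The Lebesgue volume of the ellipsoid `2 |c|² + ‖w‖² ≤ ρ`. -/
theorem volume_ellipsoid (hV : Module.finrank ℝ V = 4 * N) {ρ : ℝ} (hρ : 0 < ρ) :
    volume {p : ℂ × V | 2 * ‖p.1‖ ^ 2 + ‖p.2‖ ^ 2 ≤ ρ}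
      = ofReal (ρ ^ (2 * N + 1) * (Real.pi ^ (2 * N + 1) / (2 * (2 * N + 1)!))) := by
  have hq : Measurable fun p : ℂ × V => 2 * ‖p.1‖ ^ 2 + ‖p.2‖ ^ 2 := by fun_prop
  have : (volume : Measure (ℂ × V)).IsAddHaarMeasure :=
    inferInstanceAs ((volume : Measure ℂ).prod (volume : Measure V)).IsAddHaarMeasure
  have key := setLIntegral_sublevel_mul_Gamma (volume : Measure (ℂ × V)) hq
    (fun p => by positivity) (fun c p => by
      rw [Prod.smul_fst, Prod.smul_snd, norm_smul, norm_smul, mul_pow, mul_pow, Real.norm_eq_abs,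
        sq_abs]
      ring) (H := fun _ => 1) measurable_const 0 (fun c p hc => by simp) hρ
  have hd : Module.finrank ℝ (ℂ × V) = 2 * (2 * N + 1) := by
    rw [Module.finrank_prod, Complex.finrank_real_complex, hV]
    ring
  have hg : ∫⁻ p : ℂ × V, ofReal (Real.exp (-(2 * ‖p.1‖ ^ 2 + ‖p.2‖ ^ 2))) * 1
      = ofReal (Real.pi / 2 * Real.pi ^ (2 * N)) := by
    have hn : (Real.pi ^ ((Module.finrank ℝ V : ℝ) / 2)) = Real.pi ^ (2 * N) := by
      rw [hV, ← Real.rpow_natCast]; push_cast; congr 1; ring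
    rw [ENNReal.ofReal_mul (by positivity), ← lintegral_exp_neg_mul_sq_norm_complex two_pos,
      ← hn, ← lintegral_exp_neg_sq_norm,
      ← lintegral_prod_mul (f := fun z : ℂ => ofReal (Real.exp (-(2 * ‖z‖ ^ 2))))
        (g := fun v : V => ofReal (Real.exp (-‖v‖ ^ 2))) (by fun_prop) (by fun_prop)]
    refine lintegral_congr fun p => ?_
    rw [mul_one, ← ENNReal.ofReal_mul (Real.exp_pos _).le, ← Real.exp_add, neg_add]
  rw [setLIntegral_one, hd, hg] at key
  have e1 : (((2 * (2 * N + 1) : ℕ) : ℝ) + ((0 : ℕ) : ℝ)) / 2 = (2 * N + 1 : ℕ) := by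
    push_cast; ring
  rw [e1, Real.Gamma_nat_eq_factorial, Real.rpow_natCast, ← ENNReal.ofReal_mul (by positivity)]
    at key
  have hf : (0 : ℝ) < (2 * N + 1)! := by positivity
  rw [ENNReal.eq_div_iff (by simpa using Nat.factorial_ne_zero _) ENNReal.ofReal_ne_top
    |>.2 ((mul_comm _ _).trans key), ← ENNReal.ofReal_div_of_pos hf]
  congr 1
  field_simp
  ring

/-- The integral of the Jacobian over a slice of the product of two balls. -/
theorem lintegral_jacobian_slice (hV : Module.finrank ℝ V = 4 * N) (hS : 0 ≤ S)
    (hA : ∀ z, A (A.adjoint z) = (N : ℝ) • z) (hB : ∀ z, B (B.adjoint z) = S • z)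
    (hBA : ∀ z, B (A.adjoint z) = 0)
    (hA' : ∀ z, A' (A'.adjoint z) = (N : ℝ) • z) (hB' : ∀ z, B' (B'.adjoint z) = S • z)
    (hBA' : ∀ z, B' (A'.adjoint z) = 0) {ρ : ℝ} (hρ : 0 < ρ) :
    ∫⁻ w : V, ∫⁻ p : ℂ × V,
        (Iic ρ).indicator 1 (2 * ‖p.1 + A' p.2 - A w‖ ^ 2 + ‖w‖ ^ 2)
          * (Iic ρ).indicator 1 (2 * ‖p.1‖ ^ 2 + ‖p.2‖ ^ 2)
          * ofReal |(conj (B w) * B' p.2).im|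
      = ofReal (Real.pi ^ (4 * N + 1) * S * ρ ^ (4 * N + 2)
          / (8 * (2 * N + 1) ^ 2 * Real.Gamma (2 * N + 3 / 2) ^ 2)) := by
  set χ : ℝ → ENNReal := (Iic ρ).indicator 1
  have hχ : Measurable χ := measurable_one.indicator measurableSet_Iic
  have hm : Measurable fun x : ℂ × V × V =>
      χ (2 * ‖x.1 - A x.2.1‖ ^ 2 + ‖x.2.1‖ ^ 2) * χ (2 * ‖x.1 - A' x.2.2‖ ^ 2 + ‖x.2.2‖ ^ 2)
        * ofReal |(conj (B x.2.1) * B' x.2.2).im| :=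
    ((hχ.comp (by fun_prop)).mul (hχ.comp (by fun_prop))).mul (by fun_prop)
  set F : ℂ → V → V → ENNReal := fun z w v =>
    χ (2 * ‖z - A w‖ ^ 2 + ‖w‖ ^ 2) * χ (2 * ‖z - A' v‖ ^ 2 + ‖v‖ ^ 2)
      * ofReal |(conj (B w) * B' v).im|
  have hF : Measurable fun x : ℂ × V × V => F x.1 x.2.1 x.2.2 := hm
  have hΓ : 0 < Real.Gamma (2 * N + 3 / 2) := Real.Gamma_pos_of_pos (by positivity)
  have hπ := Real.pi_pos
  obtain ⟨U, hUz⟩ : ∃ U : ℂ → ENNReal, ∀ z,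
      ofReal (max (ρ - 2 / (2 * N + 1) * ‖z‖ ^ 2) 0 ^ (2 * N + 1 / 2 : ℝ)) = U z :=
    ⟨_, fun _ => rfl⟩
  set c₁ : ℝ := Real.pi ^ (2 * N) / √Real.pi * √S / ((2 * N + 1) * Real.Gamma (2 * N + 3 / 2))
    with hc₁
  set c₂ : ℝ := Real.pi ^ (2 * N) * √S * √Real.pi / 2
    / ((2 * N + 1) * Real.Gamma (2 * N + 3 / 2)) with hc₂
  have hset : ∀ (T : V →L[ℝ] ℂ) (z : ℂ) (G : V → ENNReal),
      ∫⁻ w, χ (2 * ‖z - T w‖ ^ 2 + ‖w‖ ^ 2) * G w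
        = ∫⁻ w in {w : V | 2 * ‖z - T w‖ ^ 2 + ‖w‖ ^ 2 ≤ ρ}, G w := by
    intro T z G
    rw [← lintegral_indicator (measurableSet_le (by fun_prop) measurable_const)]
    refine lintegral_congr fun w => ?_
    by_cases hw : 2 * ‖z - T w‖ ^ 2 + ‖w‖ ^ 2 ≤ ρ <;> simp [χ, indicator, hw]
  -- With `v` fixed, the Jacobian is the cross product of `B w` with the constant vector `B' v`. The
  -- result is proportional to `‖B' v‖`, again homogeneous of degree one, so the slice formula
  -- applies a second time, to `v`.
  have hfirst : ∀ z v, ∫⁻ w, F z w v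
      = χ (2 * ‖z - A' v‖ ^ 2 + ‖v‖ ^ 2) * (ofReal c₁ * ofReal ‖B' v‖ * U z) := by
    intro z v
    have h1 : ∀ w, F z w v = χ (2 * ‖z - A' v‖ ^ 2 + ‖v‖ ^ 2)
        * (χ (2 * ‖z - A w‖ ^ 2 + ‖w‖ ^ 2) * ofReal |(conj (B w) * B' v).im|) := fun w => by
      simp only [F]; ring
    simp_rw [h1]
    have h2 : Measurable fun w =>
        χ (2 * ‖z - A w‖ ^ 2 + ‖w‖ ^ 2) * ofReal |(conj (B w) * B' v).im| :=
      (hχ.comp (by fun_prop)).mul (by fun_prop)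
    rw [lintegral_const_mul _ h2, hset,
      setLIntegral_slice hV hA hBA (H := fun x => ofReal |(conj x * B' v).im|) (by fun_prop)
        (by simp) (fun c x hc => by
          rw [← ENNReal.ofReal_mul hc.le, ← abs_of_pos hc, ← abs_mul, abs_of_pos hc]
          congr 2
          simp
          ring) (by positivity) (lintegral_gauss_abs_im hV hB (B' v)),
      hUz, ← ENNReal.ofReal_mul (by positivity)]
    congr 3
    rw [hc₁]
    ring
  have hsecond : ∀ z, ∫⁻ v, ∫⁻ w, F z w v = ofReal (c₁ * c₂) * (U z * U z) := by
    intro z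
    simp_rw [hfirst]
    rw [hset, lintegral_mul_const _ (by fun_prop), lintegral_const_mul _ (by fun_prop),
      setLIntegral_slice hV hA' hBA' (H := fun x => ofReal ‖x‖) (by fun_prop)
        (by simp) (fun c x hc => by
          rw [norm_smul, Real.norm_of_nonneg hc.le, ENNReal.ofReal_mul hc.le])
        (by positivity) (lintegral_gauss_norm hV hB'), ← hc₂, hUz,
      ENNReal.ofReal_mul (p := c₁) (q := c₂) (by positivity)]
    ring
  -- The two half-integer exponents add up to the integer `4N + 1`, so the last integral, over the
  -- plane, is elementary.
  have hUU : ∀ z, U z * U z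
      = ofReal (max (ρ - 2 / (2 * N + 1) * ‖z‖ ^ 2) 0 ^ (4 * N + 1)) := fun z => by
    have h0 : 0 ≤ max (ρ - 2 / (2 * N + 1) * ‖z‖ ^ 2) 0 := le_max_right _ _
    rw [← hUz, ← ENNReal.ofReal_mul (by positivity), ← Real.rpow_add_of_nonneg h0 (by positivity)
      (by positivity),
      show (2 * N + 1 / 2 + (2 * N + 1 / 2) : ℝ) = (4 * N + 1 : ℕ) by push_cast; ring,
      Real.rpow_natCast]
  -- Translating the constant term by `A' v` makes the meeting point `z` the variable; for fixed `z`
  -- the two ball constraints involve `w` and `v` separately.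
  calc _ = ∫⁻ w : V, ∫⁻ v : V, ∫⁻ z : ℂ, F z w v := by
        refine lintegral_congr fun w => ?_
        have hmw : Measurable fun p : ℂ × V => χ (2 * ‖p.1 + A' p.2 - A w‖ ^ 2 + ‖w‖ ^ 2)
            * χ (2 * ‖p.1‖ ^ 2 + ‖p.2‖ ^ 2) * ofReal |(conj (B w) * B' p.2).im| :=
          ((hχ.comp (by fun_prop)).mul (hχ.comp (by fun_prop))).mul (by fun_prop)
        rw [Measure.volume_eq_prod, lintegral_prod_symm _ hmw.aemeasurable]
        refine lintegral_congr fun v => ?_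
        rw [← lintegral_sub_right_eq_self _ (A' v)]
        simp only [sub_add_cancel, F]
    _ = ∫⁻ w : V, ∫⁻ z : ℂ, ∫⁻ v : V, F z w v := by
        refine lintegral_congr fun w => lintegral_lintegral_swap ?_
        exact (hF.comp (f := fun x : V × ℂ => (x.2, w, x.1)) (by fun_prop)).aemeasurable
    _ = ∫⁻ z : ℂ, ∫⁻ w : V, ∫⁻ v : V, F z w v := by
        refine lintegral_lintegral_swap (Measurable.aemeasurable ?_)
        exact Measurable.lintegral_prod_right' (f := fun x : (V × ℂ) × V => F x.1.2 x.1.1 x.2)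
          (hF.comp (f := fun x : (V × ℂ) × V => (x.1.2, x.1.1, x.2)) (by fun_prop))
    _ = ∫⁻ z : ℂ, ∫⁻ v : V, ∫⁻ w : V, F z w v := by
        refine lintegral_congr fun z => lintegral_lintegral_swap ?_
        exact (hF.comp (f := fun x : V × V => (z, x.1, x.2)) (by fun_prop)).aemeasurable
    _ = _ := by
        simp_rw [hsecond, hUU]
        rw [lintegral_const_mul _ (by fun_prop),
          lintegral_truncated_pow_complex (by positivity) hρ,
          ← ENNReal.ofReal_mul (by positivity)]
        congr 1
        rw [hc₁, hc₂]
        generalize Real.Gamma (2 * N + 3 / 2) = Γ at hΓ ⊢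
        obtain ⟨s, hs, rfl⟩ : ∃ s, 0 ≤ s ∧ S = s ^ 2 :=
          ⟨√S, Real.sqrt_nonneg S, (Real.sq_sqrt hS).symm⟩
        rw [Real.sqrt_sq hs]
        have : √Real.pi ≠ 0 := by positivity
        push_cast
        have h2 : (4 * N + 2 : ℝ) ≠ 0 := by positivity
        have h3 : (4 * N + (2 : ℝ)) = 2 * (2 * N + 1) := by ring
        rw [h3]
        field_simp
        ring

end Slices

/-! ### A block triangular determinant. -/

section TriangularDet

/-- The determinant of a block triangular endomorphism of a product. -/
theorem LinearMap.det_add_prod_snd {M W : Type*} [AddCommGroup M] [Module ℝ M]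
    [FiniteDimensional ℝ M] [AddCommGroup W] [Module ℝ W] [FiniteDimensional ℝ W]
    (L : M →ₗ[ℝ] M) (K : W →ₗ[ℝ] M) :
    LinearMap.det ((L.coprod K).prod (LinearMap.snd ℝ M W)) = LinearMap.det L := by
  classical
  let b := Module.Free.chooseBasis ℝ M
  let b' := Module.Free.chooseBasis ℝ W
  have h : LinearMap.toMatrix (b.prod b') (b.prod b') ((L.coprod K).prod (LinearMap.snd ℝ M W))
      = Matrix.fromBlocks (LinearMap.toMatrix b b L) (LinearMap.toMatrix b' b K) 0 1 := by
    ext (i | i) (j | j) <;> simp [LinearMap.toMatrix, Matrix.one_apply, Finsupp.single_apply, eq_comm]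
  rw [← LinearMap.det_toMatrix (b.prod b'), h, Matrix.det_fromBlocks_zero₂₁,
    LinearMap.det_toMatrix, Matrix.det_one, mul_one]

end TriangularDet

/-! ### Complex coefficients and the expected number of meetings. -/

open ENNReal (ofReal)
open RealInnerProductSpace ComplexConjugate

/-- The nonconstant coefficients of a plane trigonometric curve, in complex notation: cosine
coefficients first, then sine coefficients. -/
abbrev CoeffSpace (N : ℕ) : Type := PiLp 2 fun _ : Fin N ⊕ Fin N => ℂ

namespace CoeffSpace

variable {N : ℕ}

theorem finrank_eq (N : ℕ) : Module.finrank ℝ (CoeffSpace N) = 4 * N := by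
  rw [LinearEquiv.finrank_eq (WithLp.linearEquiv 2 ℝ (Fin N ⊕ Fin N → ℂ)),
    Module.finrank_pi_fintype]
  simp
  ring

instance : (volume : Measure (ℂ × CoeffSpace N)).IsAddHaarMeasure :=
  inferInstanceAs ((volume : Measure ℂ).prod (volume : Measure (CoeffSpace N))).IsAddHaarMeasure

instance : (volume : Measure ((ℂ × CoeffSpace N) × (ℂ × CoeffSpace N))).IsAddHaarMeasure :=
  @Measure.prod.instIsAddHaarMeasure (ℂ × CoeffSpace N) _ _ _ (ℂ × CoeffSpace N) _ _ _
    volume volume _ _ _ _ _ _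

/-- The sum `∑ vᵢ wᵢ` for a real vector `v`. -/
def pairing (v : Fin N ⊕ Fin N → ℝ) : CoeffSpace N →L[ℝ] ℂ :=
  ∑ i, v i • PiLp.proj 2 (fun _ => ℂ) i

theorem pairing_apply (v : Fin N ⊕ Fin N → ℝ) (w : CoeffSpace N) :
    pairing v w = ∑ i, v i • w i := by
  simp [pairing]

theorem adjoint_pairing (v : Fin N ⊕ Fin N → ℝ) (z : ℂ) :
    (pairing v).adjoint z = WithLp.toLp 2 fun i => v i • z := by
  refine ext_inner_right ℝ fun w => ?_
  rw [ContinuousLinearMap.adjoint_inner_left, pairing_apply, inner_sum, PiLp.inner_apply]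
  exact Finset.sum_congr rfl fun i _ => by rw [real_inner_smul_right, real_inner_smul_left]

theorem pairing_adjoint_pairing (u v : Fin N ⊕ Fin N → ℝ) (z : ℂ) :
    pairing u ((pairing v).adjoint z) = (∑ i, u i * v i) • z := by
  rw [adjoint_pairing, pairing_apply, Finset.sum_smul]
  exact Finset.sum_congr rfl fun i _ => (smul_smul _ _ _)

/-- The frequencies `cos (j t)`, `sin (j t)`. -/
def wave (N : ℕ) (t : ℝ) : Fin N ⊕ Fin N → ℝ :=
  Sum.elim (fun j => Real.cos (((j : ℕ) + 1 : ℕ) * t)) (fun j => Real.sin (((j : ℕ) + 1 : ℕ) * t))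

/-- The derivatives of `wave`. -/
def waveDeriv (N : ℕ) (t : ℝ) : Fin N ⊕ Fin N → ℝ :=
  Sum.elim (fun j => -(((j : ℕ) + 1 : ℕ) * Real.sin (((j : ℕ) + 1 : ℕ) * t)))
    (fun j => ((j : ℕ) + 1 : ℕ) * Real.cos (((j : ℕ) + 1 : ℕ) * t))

/-- This sum and the next two give `A A*`, `B A*` and `B B*` for `A = pairing (wave N t)` and `B =
pairing (waveDeriv N t)`. None of them depends on `t`, so all pairs of times contribute equally. -/
theorem sum_wave_mul_wave (t : ℝ) : ∑ i, wave N t i * wave N t i = N := by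
  rw [Fintype.sum_sum_type, ← Finset.sum_add_distrib]
  simp [wave, ← sq]

theorem sum_waveDeriv_mul_wave (t : ℝ) : ∑ i, waveDeriv N t i * wave N t i = 0 := by
  rw [Fintype.sum_sum_type, ← Finset.sum_add_distrib]
  refine Finset.sum_eq_zero fun j _ => ?_
  simp only [wave, waveDeriv, Sum.elim_inl, Sum.elim_inr]
  ring

theorem sum_waveDeriv_mul_waveDeriv (t : ℝ) :
    ∑ i, waveDeriv N t i * waveDeriv N t i = ∑ j ∈ Finset.Icc 1 N, (j : ℝ) ^ 2 := by
  rw [Fintype.sum_sum_type, ← Finset.sum_add_distrib, ← Finset.Ico_add_one_right_eq_Icc,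
    ← Finset.sum_Ico_add' (fun j : ℕ => (j : ℝ) ^ 2) 0 N 1, ← Finset.range_eq_Ico,
    ← Fin.sum_univ_eq_sum_range (fun j => ((j + 1 : ℕ) : ℝ) ^ 2)]
  refine Finset.sum_congr rfl fun j _ => ?_
  simp only [waveDeriv, Sum.elim_inl, Sum.elim_inr]
  linear_combination (((j : ℕ) + 1 : ℕ) : ℝ) ^ 2
    * Real.sin_sq_add_cos_sq ((((j : ℕ) + 1 : ℕ) : ℝ) * t)

theorem hasDerivAt_wave (t : ℝ) (i : Fin N ⊕ Fin N) :
    HasDerivAt (fun t => wave N t i) (waveDeriv N t i) t := by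
  rcases i with j | j
  · have h := ((hasDerivAt_id t).const_mul (((j : ℕ) + 1 : ℕ) : ℝ)).cos
    simp only [id, mul_one] at h
    exact h.congr_deriv (by simp only [waveDeriv, Sum.elim_inl]; ring)
  · have h := ((hasDerivAt_id t).const_mul (((j : ℕ) + 1 : ℕ) : ℝ)).sin
    simp only [id, mul_one] at h
    exact h.congr_deriv (by simp only [waveDeriv, Sum.elim_inr]; ring)

theorem continuous_waveDeriv (i : Fin N ⊕ Fin N) : Continuous fun t => waveDeriv N t i := by
  rcases i with j | j
  · simp only [waveDeriv, Sum.elim_inl]; fun_prop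
  · simp only [waveDeriv, Sum.elim_inr]; fun_prop

theorem hasDerivAt_pairing_wave (t : ℝ) :
    HasDerivAt (fun t => pairing (wave N t)) (pairing (waveDeriv N t)) t := by
  unfold pairing
  exact HasDerivAt.fun_sum fun i _ => (hasDerivAt_wave t i).smul_const
    (PiLp.proj 2 (fun _ : Fin N ⊕ Fin N => ℂ) i : CoeffSpace N →L[ℝ] ℂ)

theorem continuous_pairing_waveDeriv : Continuous fun t => pairing (waveDeriv N t) := by
  unfold pairing
  exact continuous_finsetSum _ fun i _ => (continuous_waveDeriv i).smul
    (continuous_const (y := (PiLp.proj 2 (fun _ : Fin N ⊕ Fin N => ℂ) i : CoeffSpace N →L[ℝ] ℂ)))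

theorem continuous_pairing_wave : Continuous fun t => pairing (wave N t) :=
  continuous_iff_continuousAt.2 fun t => (hasDerivAt_pairing_wave t).continuousAt


/-- The point at time `t` of the curve with constant term `p.1` and coefficients `p.2`. -/
def value (p : ℂ × CoeffSpace N) (t : ℝ) : ℂ := p.1 + pairing (wave N t) p.2

/-- The velocity of the curve. -/
def velocity (p : ℂ × CoeffSpace N) (t : ℝ) : ℂ := pairing (waveDeriv N t) p.2

/-- The squared norm of the curve. -/
def sqNorm (p : ℂ × CoeffSpace N) : ℝ := 2 * ‖p.1‖ ^ 2 + ‖p.2‖ ^ 2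

variable (N) in
/-- Pairs of curves. -/
abbrev Pairs : Type := (ℂ × CoeffSpace N) × (ℂ × CoeffSpace N)

instance : BorelSpace (Pairs N) := Prod.borelSpace

/-- The parameters of the intersections of two curves. -/
def meetings (p : Pairs N) : Set (ℝ × ℝ) :=
  {q | q.1 ∈ Ico 0 (2 * Real.pi) ∧ q.2 ∈ Ico 0 (2 * Real.pi) ∧ value p.1 q.1 = value p.2 q.2}

/-- The constant term of the first curve is read as a pair of times and replaced so that the two
curves meet at these times. -/
def meetAt (p : Pairs N) : Pairs N :=
  ((value p.2 p.1.1.im - pairing (wave N p.1.1.re) p.1.2, p.1.2), p.2)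

/-- The derivative of `meetAt`. -/
def meetAtDeriv (p : Pairs N) : Pairs N →L[ℝ] Pairs N :=
  let c : Pairs N →L[ℝ] ℂ := (ContinuousLinearMap.fst ℝ _ _).comp (ContinuousLinearMap.fst ℝ _ _)
  let w : Pairs N →L[ℝ] CoeffSpace N :=
    (ContinuousLinearMap.snd ℝ _ _).comp (ContinuousLinearMap.fst ℝ _ _)
  let c' : Pairs N →L[ℝ] ℂ := (ContinuousLinearMap.fst ℝ _ _).comp (ContinuousLinearMap.snd ℝ _ _)
  let w' : Pairs N →L[ℝ] CoeffSpace N :=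
    (ContinuousLinearMap.snd ℝ _ _).comp (ContinuousLinearMap.snd ℝ _ _)
  ((c' + ((pairing (wave N p.1.1.im)).comp w'
      + (Complex.imCLM.comp c).smulRight (velocity p.2 p.1.1.im))
    - ((pairing (wave N p.1.1.re)).comp w
      + (Complex.reCLM.comp c).smulRight (velocity p.1 p.1.1.re))).prod w).prod
    (ContinuousLinearMap.snd ℝ _ _)

theorem hasFDerivAt_pairing_wave {X : Type*} [NormedAddCommGroup X] [NormedSpace ℝ X] {x : X}
    {τ : X → ℝ} {τ' : X →L[ℝ] ℝ} (hτ : HasFDerivAt τ τ' x) (ω : X →L[ℝ] CoeffSpace N) :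
    HasFDerivAt (fun y => pairing (wave N (τ y)) (ω y))
      ((pairing (wave N (τ x))).comp ω
        + τ'.smulRight (pairing (waveDeriv N (τ x)) (ω x))) x := by
  have h0 : HasFDerivAt (fun y => pairing (wave N (τ y)))
      (τ'.smulRight (pairing (waveDeriv N (τ x)))) x :=
    ((hasDerivAt_pairing_wave (N := N) (τ x)).hasFDerivAt.comp x hτ).congr_fderiv (by
      ext y; simp)
  have h := h0.clm_apply ω.hasFDerivAt
  refine h.congr_fderiv ?_
  ext y
  simp

theorem hasFDerivAt_meetAt (p : Pairs N) : HasFDerivAt meetAt (meetAtDeriv p) p := by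
  have h1 : HasFDerivAt (fun p : Pairs N => p.1.1.im) (Complex.imCLM.comp
      ((ContinuousLinearMap.fst ℝ _ _).comp (ContinuousLinearMap.fst ℝ _ _))) p :=
    (Complex.imCLM.comp ((ContinuousLinearMap.fst ℝ ℂ (CoeffSpace N)).comp
      (ContinuousLinearMap.fst ℝ _ (ℂ × CoeffSpace N)))).hasFDerivAt
  have h2 : HasFDerivAt (fun p : Pairs N => p.1.1.re) (Complex.reCLM.comp
      ((ContinuousLinearMap.fst ℝ _ _).comp (ContinuousLinearMap.fst ℝ _ _))) p :=
    (Complex.reCLM.comp ((ContinuousLinearMap.fst ℝ ℂ (CoeffSpace N)).comp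
      (ContinuousLinearMap.fst ℝ _ (ℂ × CoeffSpace N)))).hasFDerivAt
  have h3 := hasFDerivAt_pairing_wave h1
    ((ContinuousLinearMap.snd ℝ ℂ (CoeffSpace N)).comp
      (ContinuousLinearMap.snd ℝ (ℂ × CoeffSpace N) _))
  have h4 := hasFDerivAt_pairing_wave h2
    ((ContinuousLinearMap.snd ℝ ℂ (CoeffSpace N)).comp
      (ContinuousLinearMap.fst ℝ _ (ℂ × CoeffSpace N)))
  have h5 : HasFDerivAt (fun p : Pairs N => p.2.1) ((ContinuousLinearMap.fst ℝ _ _).comp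
      (ContinuousLinearMap.snd ℝ _ _)) p :=
    ((ContinuousLinearMap.fst ℝ ℂ (CoeffSpace N)).comp
      (ContinuousLinearMap.snd ℝ (ℂ × CoeffSpace N) _)).hasFDerivAt
  exact (((h5.add h3).sub h4).prodMk (ContinuousLinearMap.hasFDerivAt
    ((ContinuousLinearMap.snd ℝ ℂ (CoeffSpace N)).comp
      (ContinuousLinearMap.fst ℝ _ (ℂ × CoeffSpace N))))).prodMk hasFDerivAt_snd

/-- `meetAt` changes only the first constant term, so its derivative is block triangular and the
determinant is that of the block `L` on `ℂ`. The columns of `L` are minus the first velocity and the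
second velocity. -/
theorem det_meetAtDeriv (p : Pairs N) :
    (meetAtDeriv p).det = -(conj (velocity p.1 p.1.1.re) * velocity p.2 p.1.1.im).im := by
  set L : ℂ →ₗ[ℝ] ℂ := (Complex.imLm.smulRight (velocity p.2 p.1.1.im))
    - (Complex.reLm.smulRight (velocity p.1 p.1.1.re))
  set K : CoeffSpace N × (ℂ × CoeffSpace N) →ₗ[ℝ] ℂ :=
    (-(pairing (wave N p.1.1.re)).toLinearMap).coprod
      (LinearMap.id.coprod (pairing (wave N p.1.1.im)).toLinearMap)
  set e : Pairs N ≃ₗ[ℝ] ℂ × (CoeffSpace N × (ℂ × CoeffSpace N)) :=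
    LinearEquiv.prodAssoc ℝ ℂ (CoeffSpace N) (ℂ × CoeffSpace N)
  have h : (e : Pairs N →ₗ[ℝ] _) ∘ₗ (meetAtDeriv p).toLinearMap ∘ₗ (e.symm : _ →ₗ[ℝ] Pairs N)
      = (L.coprod K).prod (LinearMap.snd ℝ _ _) := by
    refine LinearMap.ext fun x => ?_
    obtain ⟨c, w, c', w'⟩ := x
    refine Prod.ext ?_ rfl
    change c' + (pairing (wave N p.1.1.im) w' + c.im • velocity p.2 p.1.1.im)
        - (pairing (wave N p.1.1.re) w + c.re • velocity p.1 p.1.1.re)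
      = (c.im • velocity p.2 p.1.1.im - c.re • velocity p.1 p.1.1.re)
        + (-(pairing (wave N p.1.1.re) w) + (c' + pairing (wave N p.1.1.im) w'))
    abel
  have h2 := LinearMap.det_conj (meetAtDeriv p).toLinearMap e
  rw [h, LinearMap.det_add_prod_snd] at h2
  rw [ContinuousLinearMap.det, ← h2, ← LinearMap.det_toMatrix Complex.basisOneI,
    Matrix.det_fin_two]
  simp [LinearMap.toMatrix_apply, L]
  ring

theorem continuous_det_meetAtDeriv : Continuous fun p : Pairs N => (meetAtDeriv p).det := by
  simp_rw [det_meetAtDeriv, velocity]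
  have h1 : Continuous fun p : Pairs N => pairing (waveDeriv N p.1.1.re) p.1.2 :=
    (continuous_pairing_waveDeriv.comp (by fun_prop)).clm_apply (by fun_prop)
  have h2 : Continuous fun p : Pairs N => pairing (waveDeriv N p.1.1.im) p.2.2 :=
    (continuous_pairing_waveDeriv.comp (by fun_prop)).clm_apply (by fun_prop)
  fun_prop

theorem continuous_meetAt : Continuous (meetAt : Pairs N → Pairs N) :=
  continuous_iff_continuousAt.2 fun p => (hasFDerivAt_meetAt p).continuousAt

/-- Pairs whose first constant term encodes two times in a period. -/
def timeDomain : Set ℂ := Ico 0 (2 * Real.pi) ×ℂ Ico 0 (2 * Real.pi)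

theorem measurableSet_timeDomain : MeasurableSet timeDomain :=
  (Complex.measurable_re measurableSet_Ico).inter (Complex.measurable_im measurableSet_Ico)

theorem volume_timeDomain : volume timeDomain = ofReal (4 * Real.pi ^ 2) := by
  have h : timeDomain = Complex.measurableEquivRealProd ⁻¹'
      (Ico 0 (2 * Real.pi) ×ˢ Ico 0 (2 * Real.pi)) := rfl
  rw [h, Complex.volume_preserving_equiv_real_prod.measure_preimage
    (measurableSet_Ico.prod measurableSet_Ico).nullMeasurableSet, Measure.volume_eq_prod,
    Measure.prod_prod, Real.volume_Ico, sub_zero,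
    ← ENNReal.ofReal_mul (by have := Real.pi_pos; positivity)]
  congr 1
  ring

/-- A preimage of `y` shares with it everything but the first constant term. Only the two times are
free, and matching that term says that the curves of `y` meet at these times. -/
theorem encard_meetAt_fiber (y : Pairs N) :
    ({p : Pairs N | p.1.1 ∈ timeDomain} ∩ meetAt ⁻¹' {y}).encard = (meetings y).encard := by
  have h : {p : Pairs N | p.1.1 ∈ timeDomain} ∩ meetAt ⁻¹' {y}
      = (fun q : ℝ × ℝ => (((⟨q.1, q.2⟩ : ℂ), y.1.2), y.2)) '' meetings y := by
    ext p
    constructor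
    · rintro ⟨⟨hr, hi⟩, rfl⟩
      refine ⟨(p.1.1.re, p.1.1.im), ⟨hr, hi, ?_⟩, rfl⟩
      simp [value, meetAt]
    · rintro ⟨q, ⟨h1, h2, h3⟩, rfl⟩
      refine ⟨⟨h1, h2⟩, ?_⟩
      simp only [mem_preimage, mem_singleton_iff, meetAt, ← h3]
      simp [value]
  rw [h, InjOn.encard_image]
  rintro ⟨a, b⟩ - ⟨a', b'⟩ - hab
  simpa using hab

theorem measurable_sqNorm : Measurable (sqNorm : ℂ × CoeffSpace N → ℝ) := by
  unfold sqNorm; fun_prop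

theorem aemeasurable_encard_meetings :
    AEMeasurable fun y : Pairs N => (((meetings y).encard : ℕ∞) : ENNReal) := by
  simp_rw [← encard_meetAt_fiber]
  exact (aemeasurable_encard_fiber_and_lintegral volume
    (measurableSet_timeDomain.preimage (by fun_prop))
    (fun p _ => (hasFDerivAt_meetAt p).hasFDerivWithinAt)
    continuous_det_meetAtDeriv.measurable).1

/-- The integral of the number of meetings over a product of two balls. -/
theorem lintegral_encard_meetings {ρ : ℝ} (hρ : 0 < ρ) :
    ∫⁻ y in {y : Pairs N | sqNorm y.1 ≤ ρ ∧ sqNorm y.2 ≤ ρ},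
        (((meetings y).encard : ℕ∞) : ENNReal)
      = ofReal (4 * Real.pi ^ 2 * (Real.pi ^ (4 * N + 1) * (∑ j ∈ Finset.Icc 1 N, (j : ℝ) ^ 2)
          * ρ ^ (4 * N + 2) / (8 * (2 * N + 1) ^ 2 * Real.Gamma (2 * N + 3 / 2) ^ 2))) := by
  set Q : Set (Pairs N) := {y | sqNorm y.1 ≤ ρ ∧ sqNorm y.2 ≤ ρ} with hQ
  have mQ : MeasurableSet Q :=
    (measurableSet_le (measurable_sqNorm.comp measurable_fst) measurable_const).inter
      (measurableSet_le (measurable_sqNorm.comp measurable_snd) measurable_const)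
  have mD : MeasurableSet {p : Pairs N | p.1.1 ∈ timeDomain} :=
    measurableSet_timeDomain.preimage (by fun_prop)
  have mQ' : MeasurableSet (meetAt ⁻¹' Q) := continuous_meetAt.measurable mQ
  have key := (aemeasurable_encard_fiber_and_lintegral (volume : Measure (Pairs N)) (mD.inter mQ')
    (fun p _ => (hasFDerivAt_meetAt p).hasFDerivWithinAt)
    continuous_det_meetAtDeriv.measurable).2
  have hfib : ∀ y, (((({p : Pairs N | p.1.1 ∈ timeDomain} ∩ meetAt ⁻¹' Q)
      ∩ meetAt ⁻¹' {y}).encard : ℕ∞) : ENNReal)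
      = Q.indicator (fun y => (((meetings y).encard : ℕ∞) : ENNReal)) y := by
    intro y
    by_cases hy : y ∈ Q
    · rw [indicator_of_mem hy, ← encard_meetAt_fiber, inter_assoc,
        inter_eq_right.2 (preimage_mono (singleton_subset_iff.2 hy))]
    · rw [indicator_of_notMem hy, inter_assoc, ← preimage_inter,
        inter_singleton_eq_empty.2 hy]
      simp
  simp_rw [hfib] at key
  rw [lintegral_indicator mQ] at key
  rw [key, ← lintegral_indicator (mD.inter mQ')]
  set χ : ℝ → ENNReal := (Iic ρ).indicator 1 with hχdef
  have hχ : Measurable χ := measurable_one.indicator measurableSet_Iic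
  have hpt : ∀ p : Pairs N, ({p : Pairs N | p.1.1 ∈ timeDomain} ∩ meetAt ⁻¹' Q).indicator
      (fun p => ofReal |(meetAtDeriv p).det|) p
      = timeDomain.indicator 1 p.1.1 *
        (χ (2 * ‖p.2.1 + pairing (wave N p.1.1.im) p.2.2 - pairing (wave N p.1.1.re) p.1.2‖ ^ 2
          + ‖p.1.2‖ ^ 2) * χ (2 * ‖p.2.1‖ ^ 2 + ‖p.2.2‖ ^ 2)
          * ofReal |(conj (pairing (waveDeriv N p.1.1.re) p.1.2)
            * pairing (waveDeriv N p.1.1.im) p.2.2).im|) := by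
    intro p
    have hmem : p ∈ {p : Pairs N | p.1.1 ∈ timeDomain} ∩ meetAt ⁻¹' Q ↔ p.1.1 ∈ timeDomain ∧
        2 * ‖p.2.1 + pairing (wave N p.1.1.im) p.2.2 - pairing (wave N p.1.1.re) p.1.2‖ ^ 2
          + ‖p.1.2‖ ^ 2 ≤ ρ ∧ 2 * ‖p.2.1‖ ^ 2 + ‖p.2.2‖ ^ 2 ≤ ρ := Iff.rfl
    simp only [indicator, hmem, hχdef, det_meetAtDeriv, abs_neg, mem_Iic, Pi.one_apply, velocity]
    by_cases h1 : p.1.1 ∈ timeDomain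
    · by_cases h2 : 2 * ‖p.2.1 + pairing (wave N p.1.1.im) p.2.2
          - pairing (wave N p.1.1.re) p.1.2‖ ^ 2 + ‖p.1.2‖ ^ 2 ≤ ρ
      · by_cases h3 : 2 * ‖p.2.1‖ ^ 2 + ‖p.2.2‖ ^ 2 ≤ ρ
        · rw [if_pos ⟨h1, h2, h3⟩, if_pos h1, if_pos h2, if_pos h3, one_mul, one_mul, one_mul]
        · rw [if_neg fun h => h3 h.2.2, if_neg h3, mul_zero, zero_mul, mul_zero]
      · rw [if_neg fun h => h2 h.2.1, if_neg h2, zero_mul, zero_mul, mul_zero]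
    · rw [if_neg fun h => h1 h.1, if_neg h1, zero_mul]
  have mT : Measurable (timeDomain.indicator (1 : ℂ → ENNReal)) :=
    measurable_one.indicator measurableSet_timeDomain
  have hmeas : Measurable fun p : Pairs N =>
      timeDomain.indicator (1 : ℂ → ENNReal) p.1.1 *
        (χ (2 * ‖p.2.1 + pairing (wave N p.1.1.im) p.2.2 - pairing (wave N p.1.1.re) p.1.2‖ ^ 2
          + ‖p.1.2‖ ^ 2) * χ (2 * ‖p.2.1‖ ^ 2 + ‖p.2.2‖ ^ 2)
          * ofReal |(conj (pairing (waveDeriv N p.1.1.re) p.1.2)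
            * pairing (waveDeriv N p.1.1.im) p.2.2).im|) := by
    have h1 : Continuous fun p : Pairs N => pairing (waveDeriv N p.1.1.re) p.1.2 :=
      (continuous_pairing_waveDeriv.comp (by fun_prop)).clm_apply (by fun_prop)
    have h2 : Continuous fun p : Pairs N => pairing (waveDeriv N p.1.1.im) p.2.2 :=
      (continuous_pairing_waveDeriv.comp (by fun_prop)).clm_apply (by fun_prop)
    have h3 : Continuous fun p : Pairs N => pairing (wave N p.1.1.re) p.1.2 :=
      (continuous_pairing_wave.comp (by fun_prop)).clm_apply (by fun_prop)
    have h4 : Continuous fun p : Pairs N => pairing (wave N p.1.1.im) p.2.2 :=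
      (continuous_pairing_wave.comp (by fun_prop)).clm_apply (by fun_prop)
    exact (mT.comp (by fun_prop)).mul (((hχ.comp (Continuous.measurable (by fun_prop))).mul
      (hχ.comp (by fun_prop))).mul
      (ENNReal.measurable_ofReal.comp (Continuous.measurable (by fun_prop))))
  have hS : 0 ≤ ∑ j ∈ Finset.Icc 1 N, (j : ℝ) ^ 2 := Finset.sum_nonneg fun _ _ => sq_nonneg _
  have hAA : ∀ t z, pairing (wave N t) ((pairing (wave N t)).adjoint z) = (N : ℝ) • z :=
    fun t z => by rw [pairing_adjoint_pairing, sum_wave_mul_wave]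
  have hBB : ∀ t z, pairing (waveDeriv N t) ((pairing (waveDeriv N t)).adjoint z)
      = (∑ j ∈ Finset.Icc 1 N, (j : ℝ) ^ 2) • z :=
    fun t z => by rw [pairing_adjoint_pairing, sum_waveDeriv_mul_waveDeriv]
  have hBA : ∀ t z, pairing (waveDeriv N t) ((pairing (wave N t)).adjoint z) = 0 :=
    fun t z => by rw [pairing_adjoint_pairing, sum_waveDeriv_mul_wave, zero_smul]
  simp_rw [hpt]
  rw [Measure.volume_eq_prod, lintegral_prod _ hmeas.aemeasurable, Measure.volume_eq_prod,
    lintegral_prod _ hmeas.lintegral_prod_right'.aemeasurable]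
  -- The slice integral is the same for all times, so integrating over the times only contributes
  -- the area `4π²` of the square.
  have hinner : ∀ c : ℂ, ∫⁻ w : CoeffSpace N, ∫⁻ b : ℂ × CoeffSpace N,
      timeDomain.indicator (1 : ℂ → ENNReal) c *
        (χ (2 * ‖b.1 + pairing (wave N c.im) b.2 - pairing (wave N c.re) w‖ ^ 2
          + ‖w‖ ^ 2) * χ (2 * ‖b.1‖ ^ 2 + ‖b.2‖ ^ 2)
          * ofReal |(conj (pairing (waveDeriv N c.re) w)
            * pairing (waveDeriv N c.im) b.2).im|)
      = timeDomain.indicator (1 : ℂ → ENNReal) c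
        * ofReal (Real.pi ^ (4 * N + 1) * (∑ j ∈ Finset.Icc 1 N, (j : ℝ) ^ 2)
          * ρ ^ (4 * N + 2) / (8 * (2 * N + 1) ^ 2 * Real.Gamma (2 * N + 3 / 2) ^ 2)) := by
    intro c
    have hc : timeDomain.indicator (1 : ℂ → ENNReal) c ≠ ⊤ := by
      by_cases h : c ∈ timeDomain <;> simp [h]
    simp_rw [lintegral_const_mul' _ _ hc]
    rw [lintegral_jacobian_slice (finrank_eq N) hS (hAA _) (hBB _) (hBA _) (hAA _) (hBB _)
      (hBA _) hρ]
  refine (lintegral_congr hinner).trans ?_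
  rw [lintegral_mul_const _ mT, lintegral_indicator_one
    measurableSet_timeDomain, volume_timeDomain, ← ENNReal.ofReal_mul (by positivity)]

end CoeffSpace

/-! ### Exceptional pairs: infinitely many meetings, or repeated intersection points. -/

/-- The image of a set under a map that does not depend on some direction is null. -/
theorem measure_image_eq_zero_of_invariant {E : Type*} [NormedAddCommGroup E] [NormedSpace ℝ E]
    [FiniteDimensional ℝ E] [MeasurableSpace E] [BorelSpace E] (μ : Measure E)
    [μ.IsAddHaarMeasure] {f : E → E} {s : Set E} (hf : ∀ x ∈ s, DifferentiableAt ℝ f x) {e : E}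
    (he : e ≠ 0) (h : ∀ x (r : ℝ), f (x + r • e) = f x) : μ (f '' s) = 0 := by
  refine addHaar_image_eq_zero_of_det_fderivWithin_eq_zero μ
    (fun x hx => (hf x hx).hasFDerivAt.hasFDerivWithinAt) (fun x hx => ?_)
  by_contra hdet
  have h1 : HasDerivAt (fun r : ℝ => f (x + r • e)) (fderiv ℝ f x e) 0 :=
    (hf x hx).hasFDerivAt.hasLineDerivAt e
  simp only [h] at h1
  have h2 : fderiv ℝ f x e = 0 := h1.unique (hasDerivAt_const _ _)
  apply he
  apply ((fderiv ℝ f x).toContinuousLinearEquivOfDetNeZero hdet).injective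
  simpa using h2

namespace CoeffSpace

variable {N : ℕ}

/-- The vector with a single nonzero coefficient. -/
def coord (i : Fin N ⊕ Fin N) : ℂ →L[ℝ] CoeffSpace N :=
  (PiLp.continuousLinearEquiv 2 ℝ fun _ : Fin N ⊕ Fin N => ℂ).symm.toContinuousLinearMap.comp
    (ContinuousLinearMap.single ℝ (fun _ : Fin N ⊕ Fin N => ℂ) i)

theorem coord_same (i : Fin N ⊕ Fin N) (z : ℂ) : coord i z i = z := by
  simp [coord]

theorem coord_ne {i k : Fin N ⊕ Fin N} (h : k ≠ i) (z : ℂ) : coord i z k = 0 := by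
  simp [coord, h]

theorem pairing_coord (v : Fin N ⊕ Fin N → ℝ) (i : Fin N ⊕ Fin N) (z : ℂ) :
    pairing v (coord i z) = v i • z := by
  rw [pairing_apply, Finset.sum_eq_single i (fun k _ hk => by rw [coord_ne hk, smul_zero])
    (fun h => absurd (Finset.mem_univ i) h), coord_same]

/-- The coefficients `w` with the `i`-th one replaced so that the curve takes the same value at
`t` and at `u`. -/
def closeUp (i : Fin N ⊕ Fin N) (t u : ℝ) (w : CoeffSpace N) : CoeffSpace N :=
  w - coord i ((wave N t i - wave N u i)⁻¹ • (pairing (wave N t) w - pairing (wave N u) w))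

/-- Closing up recovers the `i`-th coefficient whatever stood in its place. That slot can therefore
store the two times `t` and `u` as real and imaginary part. -/
theorem closeUp_eq {i : Fin N ⊕ Fin N} {t u : ℝ} (h : wave N t i ≠ wave N u i)
    {w : CoeffSpace N} (hw : pairing (wave N t) w = pairing (wave N u) w) (z : ℂ) :
    closeUp i t u (w + coord i z) = w := by
  have h' : wave N t i - wave N u i ≠ 0 := sub_ne_zero.2 h
  have : pairing (wave N t) (w + coord i z) - pairing (wave N u) (w + coord i z)
      = (wave N t i - wave N u i) • z := by
    rw [map_add, map_add, hw, pairing_coord, pairing_coord, add_sub_add_left_eq_sub, ← sub_smul]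
  rw [closeUp, this, smul_smul, inv_mul_cancel₀ h', one_smul, add_sub_cancel_right]

/-- A parametrization of the pairs for which the second curve passes through a double point of
the first. It does not depend on the imaginary part of the constant term of the second curve. -/
def throughDouble (i : Fin N ⊕ Fin N) (p : Pairs N) : Pairs N :=
  ((p.1.1, closeUp i (p.1.2 i).re (p.1.2 i).im p.1.2),
    (p.1.1 + pairing (wave N (p.1.2 i).re) (closeUp i (p.1.2 i).re (p.1.2 i).im p.1.2)
      - pairing (wave N p.2.1.re) p.2.2, p.2.2))

theorem differentiableAt_throughDouble {i : Fin N ⊕ Fin N} {p : Pairs N}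
    (h : wave N (p.1.2 i).re i ≠ wave N (p.1.2 i).im i) :
    DifferentiableAt ℝ (throughDouble i) p := by
  have h' : wave N (p.1.2 i).re i - wave N (p.1.2 i).im i ≠ 0 := sub_ne_zero.2 h
  set ω : Pairs N →L[ℝ] CoeffSpace N :=
    (ContinuousLinearMap.snd ℝ ℂ (CoeffSpace N)).comp
      (ContinuousLinearMap.fst ℝ _ (ℂ × CoeffSpace N))
  have hw : DifferentiableAt ℝ (fun p : Pairs N => p.1.2) p := ω.differentiableAt
  have hw' : DifferentiableAt ℝ (fun p : Pairs N => p.2.2) p :=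
    ((ContinuousLinearMap.snd ℝ ℂ (CoeffSpace N)).comp
      (ContinuousLinearMap.snd ℝ (ℂ × CoeffSpace N) _)).differentiableAt
  have hwi : DifferentiableAt ℝ (fun p : Pairs N => p.1.2 i) p :=
    ((PiLp.proj 2 (𝕜 := ℝ) (fun _ : Fin N ⊕ Fin N => ℂ) i).comp ω).differentiableAt
  have hr : DifferentiableAt ℝ (fun p : Pairs N => (p.1.2 i).re) p :=
    Complex.reCLM.differentiableAt.comp p hwi
  have hi : DifferentiableAt ℝ (fun p : Pairs N => (p.1.2 i).im) p :=
    Complex.imCLM.differentiableAt.comp p hwi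
  have hc : DifferentiableAt ℝ (fun p : Pairs N => p.2.1.re) p :=
    Complex.reCLM.differentiableAt.comp p (by fun_prop)
  have hP : ∀ {τ : Pairs N → ℝ} {v : Pairs N → CoeffSpace N}, DifferentiableAt ℝ τ p →
      DifferentiableAt ℝ v p → DifferentiableAt ℝ (fun p => pairing (wave N (τ p)) (v p)) p :=
    fun hτ hv => DifferentiableAt.clm_apply
      ((hasDerivAt_pairing_wave _).differentiableAt.comp p hτ) hv
  have hW : ∀ {τ : Pairs N → ℝ}, DifferentiableAt ℝ τ p →
      DifferentiableAt ℝ (fun p => wave N (τ p) i) p :=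
    fun hτ => (hasDerivAt_wave _ i).differentiableAt.comp p hτ
  have hclose : DifferentiableAt ℝ
      (fun p : Pairs N => closeUp i (p.1.2 i).re (p.1.2 i).im p.1.2) p :=
    hw.sub ((coord i).differentiableAt.comp p
      ((((hW hr).sub (hW hi)).inv h').smul ((hP hr hw).sub (hP hi hw))))
  exact (DifferentiableAt.prodMk (by fun_prop) hclose).prodMk
    (((DifferentiableAt.add (by fun_prop) (hP hr hclose)).sub (hP hc hw')).prodMk hw')

/-- A double point on the first curve frees the slot `i`, which stores `t` and `u`; passing through
it determines the second constant term from `s`, which takes only the real part of that slot. The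
imaginary part stays idle, so all such pairs lie in a null image. -/
theorem volume_throughDouble_eq_zero (i : Fin N ⊕ Fin N) :
    volume {p : Pairs N | ∃ t u s : ℝ, wave N t i ≠ wave N u i ∧ value p.1 t = value p.1 u ∧
      value p.1 t = value p.2 s} = 0 := by
  refine measure_mono_null ?_ (measure_image_eq_zero_of_invariant volume
    (s := {p : Pairs N | wave N (p.1.2 i).re i ≠ wave N (p.1.2 i).im i})
    (fun p hp => differentiableAt_throughDouble hp) (e := ((0, 0), (Complex.I, 0)))
    (by simp [Prod.ext_iff]) (fun p r => by simp [throughDouble]))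
  rintro ⟨⟨c, w⟩, ⟨c', w'⟩⟩ ⟨t, u, s, hne, h1, h2⟩
  have hi : (w + coord i (⟨t, u⟩ - w i)) i = ⟨t, u⟩ := by
    rw [PiLp.add_apply, coord_same]; ring
  have h1' : pairing (wave N t) w = pairing (wave N u) w := add_left_cancel h1
  refine ⟨((c, w + coord i (⟨t, u⟩ - w i)), ((s : ℂ), w')), ?_, ?_⟩
  · simp only [mem_ofPred_eq, hi]
    exact hne
  · simp only [throughDouble, hi, closeUp_eq hne h1', Complex.ofReal_re]
    simp only [value] at h2
    rw [h2, add_sub_cancel_right]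

theorem eq_of_wave_eq (hN : 0 < N) {t u : ℝ} (ht : t ∈ Ico 0 (2 * Real.pi))
    (hu : u ∈ Ico 0 (2 * Real.pi))
    (h1 : wave N t (Sum.inl ⟨0, hN⟩) = wave N u (Sum.inl ⟨0, hN⟩))
    (h2 : wave N t (Sum.inr ⟨0, hN⟩) = wave N u (Sum.inr ⟨0, hN⟩)) : t = u := by
  simp only [wave, Sum.elim_inl, Sum.elim_inr, zero_add, Nat.cast_one, one_mul] at h1 h2
  obtain ⟨k, hk⟩ := Real.Angle.angle_eq_iff_two_pi_dvd_sub.1 (Real.Angle.cos_sin_inj h1 h2)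
  have hπ := Real.pi_pos
  have h3 : (k : ℝ) < 1 := by nlinarith [ht.1, ht.2, hu.1, hu.2]
  have h4 : (-1 : ℝ) < k := by nlinarith [ht.1, ht.2, hu.1, hu.2]
  have h5 : k = 0 := by
    have h3' : k < 1 := by exact_mod_cast h3
    have h4' : -1 < k := by exact_mod_cast h4
    omega
  rw [h5] at hk
  simp at hk
  linarith

theorem ae_of_forall_ball {P : Pairs N → Prop}
    (h : ∀ ρ : ℝ, 0 < ρ → ∀ᵐ p : Pairs N, sqNorm p.1 ≤ ρ ∧ sqNorm p.2 ≤ ρ → P p) :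
    ∀ᵐ p : Pairs N, P p := by
  have h' : ∀ᵐ p : Pairs N, ∀ n : ℕ, sqNorm p.1 ≤ n + 1 ∧ sqNorm p.2 ≤ n + 1 → P p :=
    ae_all_iff.2 fun n => h _ (by positivity)
  filter_upwards [h'] with p hp
  obtain ⟨n, hn⟩ := exists_nat_ge (max (sqNorm p.1) (sqNorm p.2))
  exact hp n ⟨by linarith [le_max_left (sqNorm p.1) (sqNorm p.2)],
    by linarith [le_max_right (sqNorm p.1) (sqNorm p.2)]⟩

theorem measurableSet_ballPairs (ρ : ℝ) :
    MeasurableSet {y : Pairs N | sqNorm y.1 ≤ ρ ∧ sqNorm y.2 ≤ ρ} :=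
  (measurableSet_le (measurable_sqNorm.comp measurable_fst) measurable_const).inter
    (measurableSet_le (measurable_sqNorm.comp measurable_snd) measurable_const)

/-- The number of meetings has finite integral over every product of balls. -/
theorem ae_finite_meetings : ∀ᵐ p : Pairs N, (meetings p).Finite := by
  refine ae_of_forall_ball fun ρ hρ => ?_
  have h := ae_lt_top' (aemeasurable_encard_meetings (N := N)).restrict
    (lintegral_encard_meetings hρ ▸ ENNReal.ofReal_ne_top)
  rw [ae_restrict_iff' (measurableSet_ballPairs ρ)] at h
  filter_upwards [h] with p hp hmem
  have := hp hmem
  rw [← Set.encard_lt_top_iff]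
  by_contra hcon
  rw [not_lt_top_iff] at hcon
  simp [hcon] at this

theorem ae_injOn_meetings :
    ∀ᵐ p : Pairs N, InjOn (fun q : ℝ × ℝ => value p.1 q.1) (meetings p) := by
  -- Constant curves have no frequency to separate times. There the integral formula has the value
  -- `0`, so almost all pairs have no meetings at all.
  rcases Nat.eq_zero_or_pos N with rfl | hN
  · refine ae_of_forall_ball fun ρ hρ => ?_
    have h0 := lintegral_encard_meetings (N := 0) hρ
    simp only [Finset.Icc_eq_empty_of_lt one_pos, Finset.sum_empty, mul_zero, zero_mul, zero_div,
      ENNReal.ofReal_zero] at h0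
    rw [lintegral_eq_zero_iff' aemeasurable_encard_meetings.restrict, Filter.EventuallyEq,
      ae_restrict_iff' (measurableSet_ballPairs ρ)] at h0
    filter_upwards [h0] with p hp hmem
    have := hp hmem
    simp only [Pi.zero_apply, ENat.toENNReal_eq_zero, encard_eq_zero] at this
    rw [this]
    exact injOn_empty _
  · have hl := fun i : Fin N ⊕ Fin N => measure_eq_zero_iff_ae_notMem.1
      (volume_throughDouble_eq_zero i)
    -- Exchanging the curves excludes double points of the second curve on the first. Two meetings
    -- at the same point must then agree in all waves, hence in both times.
    have hr := fun i : Fin N ⊕ Fin N => measure_eq_zero_iff_ae_notMem.1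
      ((Measure.measurePreserving_swap (μ := (volume : Measure (ℂ × CoeffSpace N)))
        (ν := (volume : Measure (ℂ × CoeffSpace N)))).quasiMeasurePreserving.preimage_null
          (volume_throughDouble_eq_zero i))
    filter_upwards [ae_all_iff.2 hl, ae_all_iff.2 hr] with p hpl hpr
    rintro ⟨t, s⟩ ⟨ht, hs, hts⟩ ⟨t', s'⟩ ⟨ht', hs', hts'⟩ heq
    simp only at ht hs hts ht' hs' hts' heq
    have key : ∀ i : Fin N ⊕ Fin N, wave N t i = wave N t' i ∧ wave N s i = wave N s' i := by
      intro i
      constructor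
      · by_contra hne
        exact hpl i ⟨t, t', s, hne, heq, hts⟩
      · by_contra hne
        exact hpr i ⟨s, s', t, hne, hts.symm.trans (heq.trans hts'), hts.symm⟩
    exact Prod.ext (eq_of_wave_eq hN ht ht' (key _).1 (key _).1)
      (eq_of_wave_eq hN hs hs' (key _).2 (key _).2)

end CoeffSpace

/-! ### Transfer to `TrigCurve` and evaluation of the mean. -/

/-- A countably valued lower integral as a sum over the values. -/
theorem lintegral_encard_eq_tsum {α : Type*} [MeasurableSpace α] {μ : Measure α} {n : α → ℕ∞}
    {s : Set α} (hs : MeasurableSet s) (hn : ∀ i : ℕ, NullMeasurableSet {x | n x = i} μ)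
    (hfin : ∀ᵐ x ∂μ.restrict s, n x ≠ ⊤) :
    ∫⁻ x in s, ((n x : ℕ∞) : ENNReal) ∂μ = ∑' i : ℕ, (i : ENNReal) * μ {x ∈ s | n x = i} := by
  have h1 : ∀ᵐ x ∂μ.restrict s, ((n x : ℕ∞) : ENNReal)
      = ∑' i : ℕ, {x | n x = i}.indicator (fun _ => (i : ENNReal)) x := by
    filter_upwards [hfin] with x hx
    obtain ⟨k, hk⟩ := ENat.ne_top_iff_exists.1 hx
    rw [tsum_eq_single k, indicator_of_mem (by exact hk.symm), ← hk]
    · simp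
    · intro i hi
      rw [indicator_of_notMem]
      intro h
      have h : n x = i := h
      rw [← hk] at h
      exact hi (by exact_mod_cast h.symm)
  rw [lintegral_congr_ae h1, lintegral_tsum fun i =>
    (aemeasurable_const.indicator₀ ((hn i).mono Measure.restrict_le_self))]
  congr 1
  ext i
  rw [lintegral_indicator_const₀ ((hn i).mono Measure.restrict_le_self),
    Measure.restrict_apply' hs, inter_comm]
  rfl

namespace TrigCurve

open CoeffSpace

variable {N : ℕ}

/-- A curve in complex notation: its constant term and its other coefficients. -/
def complexCoeffs (N : ℕ) : TrigCurve N ≃ₗ[ℝ] ℂ × CoeffSpace N where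
  toFun f := (⟨f.xPoly.1, f.yPoly.1⟩, WithLp.toLp 2 (Sum.elim
    (fun j => ⟨f.xPoly.2.1 j, f.yPoly.2.1 j⟩) (fun j => ⟨f.xPoly.2.2 j, f.yPoly.2.2 j⟩)))
  invFun p := ⟨(p.1.re, fun j => (p.2 (Sum.inl j)).re, fun j => (p.2 (Sum.inr j)).re),
    (p.1.im, fun j => (p.2 (Sum.inl j)).im, fun j => (p.2 (Sum.inr j)).im)⟩
  map_add' f g := by
    refine Prod.ext (Complex.ext rfl rfl) (PiLp.ext fun i => ?_)
    rcases i with j | j <;> exact Complex.ext rfl rfl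
  map_smul' r f := by
    refine Prod.ext (by apply Complex.ext <;> simp) (PiLp.ext fun i => ?_)
    rcases i with j | j <;> apply Complex.ext <;> simp
  left_inv f := rfl
  right_inv p := by
    refine Prod.ext rfl (PiLp.ext fun i => ?_)
    rcases i with j | j <;> rfl

theorem complexCoeffs_apply (f : TrigCurve N) :
    complexCoeffs N f = (⟨f.xPoly.1, f.yPoly.1⟩, WithLp.toLp 2 (Sum.elim
      (fun j => ⟨f.xPoly.2.1 j, f.yPoly.2.1 j⟩) (fun j => ⟨f.xPoly.2.2 j, f.yPoly.2.2 j⟩))) := rfl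

theorem sqNorm_complexCoeffs (f : TrigCurve N) : sqNorm (complexCoeffs N f) = ‖f‖ ^ 2 := by
  rw [← real_inner_self_eq_norm_sq, inner_eq_dot, dot_eq, sqNorm, PiLp.norm_sq_eq_of_L2,
    Fintype.sum_sum_type, ← Finset.sum_add_distrib, Complex.sq_norm, Complex.normSq_apply]
  congr 1
  refine Finset.sum_congr rfl fun j _ => ?_
  rw [Complex.sq_norm, Complex.sq_norm, Complex.normSq_apply, Complex.normSq_apply]
  simp only [complexCoeffs_apply, Sum.elim_inl, Sum.elim_inr]
  ring

theorem value_complexCoeffs (f : TrigCurve N) (t : ℝ) :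
    value (complexCoeffs N f) t = ⟨f.x t, f.y t⟩ := by
  rw [value, pairing_apply, Fintype.sum_sum_type]
  apply Complex.ext
  · simp only [complexCoeffs_apply, wave, x, TrigPoly.eval, Complex.add_re, Complex.re_sum,
      Complex.smul_re, smul_eq_mul, Sum.elim_inl, Sum.elim_inr, mul_comm, add_assoc]
  · simp only [complexCoeffs_apply, wave, y, TrigPoly.eval, Complex.add_im, Complex.im_sum,
      Complex.smul_im, smul_eq_mul, Sum.elim_inl, Sum.elim_inr, mul_comm, add_assoc]

/-- Pairs of curves in complex notation. -/
def pairCoeffs (N : ℕ) : (TrigCurve N × TrigCurve N) ≃L[ℝ] Pairs N :=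
  (complexCoeffs N).toContinuousLinearEquiv.prodCongr (complexCoeffs N).toContinuousLinearEquiv

theorem pairCoeffs_apply (p : TrigCurve N × TrigCurve N) :
    pairCoeffs N p = (complexCoeffs N p.1, complexCoeffs N p.2) := rfl

instance : BorelSpace (TrigCurve N × TrigCurve N) := Prod.borelSpace

instance : (volume : Measure (TrigCurve N × TrigCurve N)).IsAddHaarMeasure :=
  inferInstanceAs ((volume : Measure (TrigCurve N)).prod
    (volume : Measure (TrigCurve N))).IsAddHaarMeasure

/-- Uniqueness of Haar measure. The value of `k` is never needed, as it cancels in relative volumes.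
-/
theorem exists_map_pairCoeffs_eq (N : ℕ) : ∃ k : NNReal, k ≠ 0 ∧
    (volume : Measure (TrigCurve N × TrigCurve N)).map (pairCoeffs N)
      = k • (volume : Measure (Pairs N)) := by
  have : ((volume : Measure (TrigCurve N × TrigCurve N)).map (pairCoeffs N)).IsAddHaarMeasure :=
    (pairCoeffs N).isAddHaarMeasure_map _
  exact ⟨_, (Measure.addHaarScalarFactor_pos_of_isAddHaarMeasure _ _).ne',
    Measure.isAddLeftInvariant_eq_smul _ _⟩

theorem ballPairs_eq_preimage {R : ℝ} (hR : 0 < R) : ballPairs N R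
    = pairCoeffs N ⁻¹' {y : Pairs N | sqNorm y.1 ≤ R ^ 2 ∧ sqNorm y.2 ≤ R ^ 2} := by
  ext p
  simp only [ballPairs, mem_prod, Metric.mem_closedBall, dist_zero_right, mem_preimage,
    mem_ofPred_eq, pairCoeffs_apply, sqNorm_complexCoeffs]
  rw [pow_le_pow_iff_left₀ (norm_nonneg _) hR.le two_ne_zero,
    pow_le_pow_iff_left₀ (norm_nonneg _) hR.le two_ne_zero]

theorem point_eq_iff (f g : TrigCurve N) (t s : ℝ) :
    f.point t = g.point s ↔ value (complexCoeffs N f) t = value (complexCoeffs N g) s := by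
  rw [value_complexCoeffs, value_complexCoeffs, Complex.mk.injEq, point, point, Prod.mk.injEq]

theorem intersectionParameters_eq (p : TrigCurve N × TrigCurve N) :
    intersectionParameters p.1 p.2 = meetings (pairCoeffs N p) := by
  ext q
  simp only [intersectionParameters, meetings, mem_ofPred_eq, point_eq_iff, pairCoeffs_apply]

theorem _root_.TrigPoly.eval_periodic (p : TrigPoly N) :
    Function.Periodic p.eval (2 * Real.pi) := by
  intro t
  have h : ∀ j : ℕ, ((j + 1 : ℕ) : ℝ) * (t + 2 * Real.pi)
      = ((j + 1 : ℕ) : ℝ) * t + (j + 1 : ℕ) * (2 * Real.pi) := fun j => by ring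
  simp only [TrigPoly.eval, h, Real.cos_add_nat_mul_two_pi, Real.sin_add_nat_mul_two_pi]

theorem point_periodic (f : TrigCurve N) : Function.Periodic f.point (2 * Real.pi) :=
  fun t => Prod.ext (f.xPoly.eval_periodic t) (f.yPoly.eval_periodic t)

theorem intersectionPoints_eq_image (f g : TrigCurve N) :
    intersectionPoints f g = (fun q : ℝ × ℝ => f.point q.1) '' intersectionParameters f g := by
  ext z
  constructor
  · rintro ⟨⟨t, rfl⟩, ⟨s, hs⟩⟩
    obtain ⟨t', ht', h1⟩ := f.point_periodic.exists_mem_Ico₀ Real.two_pi_pos t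
    obtain ⟨s', hs', h2⟩ := g.point_periodic.exists_mem_Ico₀ Real.two_pi_pos s
    exact ⟨(t', s'), ⟨ht', hs', by rw [← h1, ← h2, hs]⟩, h1.symm⟩
  · rintro ⟨q, ⟨-, -, h⟩, rfl⟩
    exact ⟨⟨q.1, rfl⟩, ⟨q.2, h.symm⟩⟩

theorem ae_of_ae_pairCoeffs {P : Pairs N → Prop} (h : ∀ᵐ y, P y) :
    ∀ᵐ p : TrigCurve N × TrigCurve N, P (pairCoeffs N p) := by
  obtain ⟨k, -, hk⟩ := exists_map_pairCoeffs_eq N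
  refine ae_of_ae_map (pairCoeffs N).continuous.aemeasurable ?_
  rw [hk]
  exact Measure.ae_smul_measure h k

theorem ae_finite_intersectionParameters :
    ∀ᵐ p : TrigCurve N × TrigCurve N, (intersectionParameters p.1 p.2).Finite := by
  simp_rw [intersectionParameters_eq]
  exact ae_of_ae_pairCoeffs ae_finite_meetings

theorem ae_encard_intersectionPoints :
    ∀ᵐ p : TrigCurve N × TrigCurve N, (intersectionPoints p.1 p.2).encard
      = (intersectionParameters p.1 p.2).encard := by
  filter_upwards [ae_of_ae_pairCoeffs ae_injOn_meetings] with p hp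
  rw [intersectionPoints_eq_image, InjOn.encard_image]
  intro q hq q' hq' h
  rw [intersectionParameters_eq] at hq hq'
  exact hp hq hq' ((point_eq_iff _ _ _ _).1 h)

/-- Almost everywhere the number of points is the number of parameters, which is almost everywhere
measurable by the area formula. -/
theorem nullMeasurableSet_encard_intersectionPoints (i : ℕ) :
    NullMeasurableSet
      {p : TrigCurve N × TrigCurve N | (intersectionPoints p.1 p.2).encard = i} := by
  have h1 : AEMeasurable fun p : TrigCurve N × TrigCurve N =>
      (((meetings (pairCoeffs N p)).encard : ℕ∞) : ENNReal) := by
    obtain ⟨k, -, hk⟩ := exists_map_pairCoeffs_eq N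
    refine AEMeasurable.comp_aemeasurable (f := pairCoeffs N)
      (g := fun y : Pairs N => (((meetings y).encard : ℕ∞) : ENNReal)) ?_
      (pairCoeffs N).continuous.aemeasurable
    rw [hk]
    exact aemeasurable_encard_meetings.smul_measure k
  have h2 := h1.nullMeasurableSet_preimage (measurableSet_singleton (i : ENNReal))
  refine h2.congr ?_
  filter_upwards [ae_encard_intersectionPoints (N := N)] with p hp
  refine propext ?_
  change (((meetings (pairCoeffs N p)).encard : ℕ∞) : ENNReal) = i
    ↔ (intersectionPoints p.1 p.2).encard = i
  rw [hp, intersectionParameters_eq]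
  exact_mod_cast Iff.rfl

theorem volume_ellipsoid_pairs {ρ : ℝ} (hρ : 0 < ρ) :
    volume {y : Pairs N | sqNorm y.1 ≤ ρ ∧ sqNorm y.2 ≤ ρ}
      = ofReal ((ρ ^ (2 * N + 1) * (Real.pi ^ (2 * N + 1) / (2 * (2 * N + 1)!))) ^ 2) := by
  have h : {y : Pairs N | sqNorm y.1 ≤ ρ ∧ sqNorm y.2 ≤ ρ}
      = {p : ℂ × CoeffSpace N | 2 * ‖p.1‖ ^ 2 + ‖p.2‖ ^ 2 ≤ ρ}
        ×ˢ {p : ℂ × CoeffSpace N | 2 * ‖p.1‖ ^ 2 + ‖p.2‖ ^ 2 ≤ ρ} := rfl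
  rw [h, Measure.volume_eq_prod, Measure.prod_prod, volume_ellipsoid (finrank_eq N) hρ,
    ← ENNReal.ofReal_mul (by positivity), ← sq]

/-- The powers of `ρ` and `π` cancel. The Gamma value at a half-integer is expressed by `(4N + 1)‼`,
which `(4N + 1)! = (4N + 1)‼ * 2 ^ (2N) * (2N)!` turns into factorials. -/
theorem mean_value_eq (N : ℕ) (S : ℝ) {ρ : ℝ} (hρ : 0 < ρ) :
    4 * Real.pi ^ 2 * (Real.pi ^ (4 * N + 1) * S
        * ρ ^ (4 * N + 2) / (8 * (2 * N + 1) ^ 2 * Real.Gamma (2 * N + 3 / 2) ^ 2))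
      / (ρ ^ (2 * N + 1) * (Real.pi ^ (2 * N + 1) / (2 * (2 * N + 1)!))) ^ 2
    = 2 ^ (8 * N + 3) * ((2 * N)! : ℝ) ^ 4 / ((4 * N + 1)! : ℝ) ^ 2 * S := by
  have hπ := Real.pi_pos
  have hΓ : Real.Gamma (2 * N + 3 / 2) = (4 * N + 1)‼ * √Real.pi / 2 ^ (2 * N + 1) := by
    have := Real.Gamma_nat_add_one_add_half (2 * N)
    rw [show 2 * (2 * N) + 1 = 4 * N + 1 by ring] at this
    rw [← this]
    push_cast
    ring_nf
  have hd : (4 * N + 1)! = (4 * N + 1)‼ * (2 ^ (2 * N) * (2 * N)!) := by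
    rw [Nat.factorial_eq_mul_doubleFactorial, ← Nat.doubleFactorial_two_mul,
      show 2 * (2 * N) = 4 * N by ring]
  have hf : (2 * N + 1)! = (2 * N + 1) * (2 * N)! := Nat.factorial_succ _
  have h1 : (0 : ℝ) < (4 * N + 1)‼ := by exact_mod_cast Nat.doubleFactorial_pos _
  have h2 : (0 : ℝ) < (2 * N)! := by exact_mod_cast Nat.factorial_pos _
  rw [hΓ, hd, hf, mul_pow, div_pow, mul_pow, Real.sq_sqrt hπ.le]
  push_cast
  generalize ((4 * N + 1)‼ : ℝ) = a at h1 ⊢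
  generalize ((2 * N)! : ℝ) = b at h2 ⊢
  field_simp
  ring

end TrigCurve

end

theorem theorem1 (N : ℕ) (R : ℝ) (hR : 0 < R) :
    (∀ᵐ p : TrigCurve N × TrigCurve N ∂(volume.restrict (TrigCurve.ballPairs N R)),
      (TrigCurve.intersectionParameters p.1 p.2).Finite ∧
      (TrigCurve.intersectionPoints p.1 p.2).ncard
        = (TrigCurve.intersectionParameters p.1 p.2).ncard) ∧
    (∀ i : ℕ, NullMeasurableSet (TrigCurve.pairsMeeting N R i) volume) ∧
    HasSum (fun i : ℕ => (i : ℝ) * TrigCurve.relativeVolume N R i)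
      (2 ^ (8 * N + 3) * ((2 * N)! : ℝ) ^ 4 / ((4 * N + 1)! : ℝ) ^ 2
        * ∑ j ∈ Finset.Icc 1 N, (j : ℝ) ^ 2) := by
  have hball : MeasurableSet (TrigCurve.ballPairs N R) :=
    Metric.isClosed_closedBall.measurableSet.prod Metric.isClosed_closedBall.measurableSet
  refine ⟨ae_restrict_of_ae ?_, fun i => hball.nullMeasurableSet.inter
    (TrigCurve.nullMeasurableSet_encard_intersectionPoints i), ?_⟩
  · filter_upwards [TrigCurve.ae_finite_intersectionParameters (N := N),
      TrigCurve.ae_encard_intersectionPoints (N := N)] with p h1 h2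
    exact ⟨h1, by rw [ncard, ncard, h2]⟩
  have hρ : 0 < R ^ 2 := by positivity
  obtain ⟨k, hk0, hk⟩ := TrigCurve.exists_map_pairCoeffs_eq N
  have hk0' : (k : ENNReal) ≠ 0 := by exact_mod_cast hk0
  set Q : Set (CoeffSpace.Pairs N) :=
    {y | CoeffSpace.sqNorm y.1 ≤ R ^ 2 ∧ CoeffSpace.sqNorm y.2 ≤ R ^ 2}
  have hQ : MeasurableSet Q := CoeffSpace.measurableSet_ballPairs _
  have hvol : volume (TrigCurve.ballPairs N R) = k * volume Q := by
    rw [TrigCurve.ballPairs_eq_preimage hR, ← Measure.map_apply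
      (TrigCurve.pairCoeffs N).continuous.measurable hQ, hk]
    rfl
  have hint : ∫⁻ p in TrigCurve.ballPairs N R,
      (((TrigCurve.intersectionPoints p.1 p.2).encard : ℕ∞) : ENNReal)
      = k * ∫⁻ y in Q, (((CoeffSpace.meetings y).encard : ℕ∞) : ENNReal) := by
    have h1 : ∫⁻ p in TrigCurve.ballPairs N R,
        (((TrigCurve.intersectionPoints p.1 p.2).encard : ℕ∞) : ENNReal)
        = ∫⁻ p in TrigCurve.ballPairs N R,
          (((CoeffSpace.meetings (TrigCurve.pairCoeffs N p)).encard : ℕ∞) : ENNReal) := by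
      refine lintegral_congr_ae (ae_restrict_of_ae ?_)
      filter_upwards [TrigCurve.ae_encard_intersectionPoints (N := N)] with p hp
      rw [hp, TrigCurve.intersectionParameters_eq]
    have h2 : ∫⁻ y in Q, (((CoeffSpace.meetings y).encard : ℕ∞) : ENNReal)
          ∂(volume.map (TrigCurve.pairCoeffs N))
        = ∫⁻ p in TrigCurve.ballPairs N R,
          (((CoeffSpace.meetings (TrigCurve.pairCoeffs N p)).encard : ℕ∞) : ENNReal) := by
      rw [TrigCurve.ballPairs_eq_preimage hR]
      have emb : MeasurableEmbedding (TrigCurve.pairCoeffs N) :=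
        (TrigCurve.pairCoeffs N).toHomeomorph.measurableEmbedding
      rw [emb.restrict_map, emb.lintegral_map]
    rw [h1, ← h2, hk, Measure.restrict_smul, lintegral_smul_measure]
    rfl
  have hsum := lintegral_encard_eq_tsum (μ := (volume : Measure (TrigCurve N × TrigCurve N)))
    (n := fun p => (TrigCurve.intersectionPoints p.1 p.2).encard) hball
    TrigCurve.nullMeasurableSet_encard_intersectionPoints (ae_restrict_of_ae (by
      filter_upwards [TrigCurve.ae_finite_intersectionParameters (N := N),
        TrigCurve.ae_encard_intersectionPoints (N := N)] with p h1 h2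
      rw [h2]
      exact h1.encard_lt_top.ne))
  rw [hint, CoeffSpace.lintegral_encard_meetings hρ] at hsum
  -- Finiteness of the sum in `ENNReal` is what yields convergence of the real series.
  have htop : ∑' i : ℕ, (i : ENNReal) * volume (TrigCurve.pairsMeeting N R i) ≠ ⊤ := by
    refine ne_of_eq_of_ne hsum.symm ?_
    finiteness
  have hs := (ENNReal.hasSum_toReal htop).div_const (volume.real (TrigCurve.ballPairs N R))
  rw [← ENNReal.tsum_toReal_eq (ENNReal.ne_top_of_tsum_ne_top htop)] at hs
  have e1 : (fun i : ℕ => (i : ℝ) * TrigCurve.relativeVolume N R i) = fun i : ℕ =>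
      ((i : ENNReal) * volume (TrigCurve.pairsMeeting N R i)).toReal
        / volume.real (TrigCurve.ballPairs N R) := by
    funext i
    rw [TrigCurve.relativeVolume, ENNReal.toReal_mul, mul_div_assoc]
    rfl
  have e2 : volume.real (TrigCurve.ballPairs N R) = (k : ENNReal).toReal
      * ((R ^ 2) ^ (2 * N + 1) * (Real.pi ^ (2 * N + 1) / (2 * (2 * N + 1)!))) ^ 2 := by
    rw [Measure.real, hvol, TrigCurve.volume_ellipsoid_pairs hρ, ENNReal.toReal_mul,
      ENNReal.toReal_ofReal (by positivity)]
  have e3 : ∑' i : ℕ, (i : ENNReal) * volume (TrigCurve.pairsMeeting N R i) = _ := hsum.symm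
  rw [e3, ENNReal.toReal_mul, ENNReal.toReal_ofReal (by positivity), e2,
    mul_div_mul_left _ _ (by simpa using hk0), TrigCurve.mean_value_eq N _ hρ, ← e2] at hs
  rw [e1]
  exact hs
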